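/- Let $n\ge 2$, let $\Omega\subset\mathbb{R}^n$ be a bounded open set and let $T>0$. Let $\mathcal{S}^n_0$ be the space of real symmetric $n\times n$ matrices with zero trace, and for $(v,u)\in\mathbb{R}^n\times\mathcal{S}^n_0$ put $$e(v,u)=\frac n2\,\lambda_{\max}(v\otimes v-u),$$ where $\lambda_{\max}$ denotes the largest eigenvalue. Then there exist locally integrable $\bar v:\mathbb{R}^n\times\mathbb{R}\to\mathbb{R}^n$ and $\bar u:\mathbb{R}^n\times\mathbb{R}\to\mathcal{S}^n_0$ and a distribution $\bar q$ on $\mathbb{R}^n\times\mathbb{R}$ such that $$\partial_t\bar v+\operatorname{div}\bar u+\nabla\bar q=0,\qquad \operatorname{div}\bar v=0\qquad\text{(LR)}$$ in the sense of distributions on $\mathbb{R}^n\times\mathbb{R}$, and: 1. $\bar q\equiv 0$, the pair $(\bar v,\bar u)$ is smooth in $\mathbb{R}^n\times(\mathbb{R}\setminus\{0\})$, and $\bar v\in C(\mathbb{R};L^2_w)$, i.e. $\bar v(\cdot,t)\in L^2(\mathbb{R}^n;\mathbb{R}^n)$ for every $t\in\mathbb{R}$ and $t\mapsto\int_{\mathbb{R}^n}\bar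 v(x,t)\cdot\varphi(x)\,dx$ is continuous for every $\varphi\in L^2(\mathbb{R}^n;\mathbb{R}^n)$; 2. $\operatorname{supp}(\bar v,\bar u)\subset\overline\Omega\times\,]-T,T[$; 3. for every $t\ne 0$, $\operatorname{supp}(\bar v(\cdot,t),\bar u(\cdot,t))$ is a compact subset of $\Omega$; 4. $e(\bar v(x,t),\bar u(x,t))<1$ for all $(x,t)\in\mathbb{R}^n\times(\mathbb{R}\setminus\{0\})$; 5. $\frac12|\bar v(x,0)|^2=1$ for almost every $x\in\Omega$. -/

import Mathlib

open MeasureTheory Set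
open scoped ContDiff Distributions LineDeriv

noncomputable section

namespace EulerSubsolution

/-- Euclidean space `ℝⁿ`. -/
abbrev Vec (n : ℕ) : Type := EuclideanSpace ℝ (Fin n)

/-- The space of real symmetric `n × n` matrices with zero trace. -/
def SymTraceless (n : ℕ) : Submodule ℝ (Matrix (Fin n) (Fin n) ℝ) where
  carrier := {w | w.IsSymm ∧ w.trace = 0}
  add_mem' := by
    rintro a b ⟨ha, ha'⟩ ⟨hb, hb'⟩
    exact ⟨ha.add hb, by rw [Matrix.trace_add, ha', hb', add_zero]⟩
  zero_mem' := ⟨Matrix.isSymm_zero, Matrix.trace_zero _ _⟩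
  smul_mem' := by
    rintro c a ⟨ha, ha'⟩
    exact ⟨ha.smul c, by rw [Matrix.trace_smul, ha', smul_zero]⟩

/-- The largest (real) eigenvalue of a square matrix; it is used for symmetric matrices of
positive size, for which the set of eigenvalues is finite and nonempty. -/
def lambdaMax {n : ℕ} (w : Matrix (Fin n) (Fin n) ℝ) : ℝ :=
  sSup {μ : ℝ | Module.End.HasEigenvalue (Matrix.toLin' w) μ}

/-- The generalized energy density `e(v,u) = (n/2) λ_max(v ⊗ v - u)`. -/
def genEnergy {n : ℕ} (v : Vec n) (u : SymTraceless n) : ℝ :=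
  (n : ℝ) / 2 * lambdaMax (Matrix.vecMulVec (v : Fin n → ℝ) (v : Fin n → ℝ) -
    (u : Matrix (Fin n) (Fin n) ℝ))

/-- The direction of the `i`-th space coordinate in `ℝⁿ × ℝ`. -/
def spaceDir {n : ℕ} (i : Fin n) : Vec n × ℝ := (EuclideanSpace.single i 1, 0)

/-- The direction of time in `ℝⁿ × ℝ`. -/
def timeDir (n : ℕ) : Vec n × ℝ := (0, 1)

/-- `(v, u, q)` solves, in the sense of distributions on `ℝⁿ × ℝ`, the linear system
`∂ₜ v + div u + ∇ q = 0`, `div v = 0`. Here `v` and `u` are locally integrable functions and `q`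
is a distribution. Each equation is tested, component by component, against an arbitrary
compactly supported smooth function `φ`. -/
structure SolvesLR {n : ℕ} (v : Vec n × ℝ → Vec n) (u : Vec n × ℝ → SymTraceless n)
    (q : 𝓓'((⊤ : TopologicalSpace.Opens (Vec n × ℝ)), ℝ)) : Prop where
  locallyIntegrable_v : LocallyIntegrable v
  locallyIntegrable_u : ∀ i j : Fin n,
    LocallyIntegrable (fun p => (u p : Matrix (Fin n) (Fin n) ℝ) i j)
  momentum : ∀ (i : Fin n) (φ : 𝓓((⊤ : TopologicalSpace.Opens (Vec n × ℝ)), ℝ)),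
    -(∫ p, (v p i * fderiv ℝ φ p (timeDir n) +
        ∑ j, (u p : Matrix (Fin n) (Fin n) ℝ) i j * fderiv ℝ φ p (spaceDir j)))
      + (∂_{spaceDir i} q) φ = 0
  divergence : ∀ φ : 𝓓((⊤ : TopologicalSpace.Opens (Vec n × ℝ)), ℝ),
    ∫ p, ∑ i, v p i * fderiv ℝ φ p (spaceDir i) = 0

/-- `v ∈ C(ℝ; L²_w)`: every time slice of `v` is in `L²(ℝⁿ; ℝⁿ)`, and `t ↦ v(·,t)` is continuous
for the weak topology of `L²`. -/
def WeaklyContinuousL2 {n : ℕ} (v : Vec n × ℝ → Vec n) : Prop :=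
  (∀ t : ℝ, MemLp (fun x => v (x, t)) 2 volume) ∧
    ∀ φ : Vec n → Vec n, MemLp φ 2 volume →
      Continuous fun t : ℝ => ∫ x, inner ℝ (v (x, t)) (φ x)

/-- The pair `(v, u)` is smooth on `ℝⁿ × (ℝ ∖ {0})`. -/
def SmoothOffZero {n : ℕ} (v : Vec n × ℝ → Vec n) (u : Vec n × ℝ → SymTraceless n) : Prop :=
  ContDiffOn ℝ ∞ v {p | p.2 ≠ 0} ∧
    ∀ i j : Fin n,
      ContDiffOn ℝ ∞ (fun p => (u p : Matrix (Fin n) (Fin n) ℝ) i j) {p | p.2 ≠ 0}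

end EulerSubsolution

end

open MeasureTheory Set
open scoped ContDiff Distributions LineDeriv

noncomputable section

namespace EulerSubsolution

/-! This is a convex integration argument. With D = (2/n) I - v ⊗ v + u, positive definiteness of D
gives e(v,u) < 1. Since u has trace zero, tr D = 2 - |v|², so |v|² < 2, and 2 - |v|² measures how
far a state is from the extremal value required at time zero.

One step starts from a smooth, compactly supported subsolution z and adds fast plane waves cut off
to small disjoint balls. At each point the state can be moved along a segment in a wave direction,
with amplitude at least a multiple of 2 - |v|², without losing positivity
(`exists_admissible_segment`). The potential `planarFlow` turns such a segment into an exact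
compactly supported solution with zero pressure, close to the cut-off plane wave
(`exists_norm_planarFlow_sub_le`). Its velocity is a derivative of something of size O(1/k), so it
is small in a negative norm (`weaklySmall_planarFlow`). A covering by balls then yields a
perturbation, confined to |t| ≤ ε, that raises the time-zero energy ∫|v|² by at least a fixed
multiple of ∫_Ω (2 - |v|²)² (`exists_perturbation`).

The step is iterated with time windows shrinking to {0}. Off t = 0 the sequence is locally
eventually constant, so its limit inherits smoothness, strict admissibility and supports. At t = 0
the energies increase and are bounded; together with almost orthogonality of the increments this
makes the velocities Cauchy in L² (`cauchySeq_of_norm_mono_of_inner_le`). The energy increments tend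
to 0, hence so does the integrated defect, and the strong limit satisfies |v|² = 2 a.e. in Ω
(`IsIteration.ae_limit`). Smallness of the increments against test fields, uniform in t, gives weak
continuity in time (`continuous_inner_of_tendsto`). -/

/-- Values of a pair `(v, u)`, with the matrix `u` given by its entries. -/
abbrev State (n : ℕ) : Type := Vec n × (Fin n → Fin n → ℝ)

/-! ### Admissible states and the segments they contain -/

/-- The bilinear form of the matrix `(2/n) I - v ⊗ v + u`. -/
def defect {n : ℕ} (s : State n) : LinearMap.BilinForm ℝ (Vec n) :=
  LinearMap.mk₂ ℝ (fun x y => 2 / (n : ℝ) * inner ℝ x y - inner ℝ s.1 x * inner ℝ s.1 y +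
      ∑ i, ∑ j, s.2 i j * (x i * y j))
    (fun x x' y => by
      simp only [inner_add_left, inner_add_right, PiLp.add_apply, add_mul, mul_add,
        Finset.sum_add_distrib]; ring)
    (fun c x y => by
      simp only [inner_smul_left, inner_smul_right, PiLp.smul_apply, smul_eq_mul, mul_add,
        Finset.mul_sum, conj_trivial, mul_sub]
      congr 1
      · ring
      · exact Finset.sum_congr rfl fun i _ => Finset.sum_congr rfl fun j _ => by ring)
    (fun x y y' => by
      simp only [inner_add_right, PiLp.add_apply, mul_add,
        Finset.sum_add_distrib]; ring)
    (fun c x y => by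
      simp only [inner_smul_right, PiLp.smul_apply, smul_eq_mul, mul_add,
        Finset.mul_sum, mul_sub]
      congr 1
      · ring
      · exact Finset.sum_congr rfl fun i _ => Finset.sum_congr rfl fun j _ => by ring)

lemma defect_apply {n : ℕ} (s : State n) (x y : Vec n) :
    defect s x y = 2 / (n : ℝ) * inner ℝ x y - inner ℝ s.1 x * inner ℝ s.1 y +
      ∑ i, ∑ j, s.2 i j * (x i * y j) := rfl

/-- The admissible states: those for which `(2/n) I - v ⊗ v + u` is positive definite. -/
def Admissible {n : ℕ} (s : State n) : Prop := ∀ x, x ≠ 0 → 0 < defect s x x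

/-- The symmetric states of trace zero. -/
def SymmTraceZero {n : ℕ} (s : State n) : Prop :=
  (∀ i j, s.2 i j = s.2 j i) ∧ ∑ i, s.2 i i = 0

lemma defect_single {n : ℕ} (s : State n) (i j : Fin n) :
    defect s (EuclideanSpace.single i 1) (EuclideanSpace.single j 1) =
      (if i = j then 2 / (n : ℝ) else 0) - s.1 i * s.1 j + s.2 i j := by
  rw [defect_apply]
  simp only [EuclideanSpace.inner_single_right, PiLp.single_apply]
  simp [Finset.sum_ite_eq, eq_comm]

lemma defect_comm {n : ℕ} {s : State n} (hs : ∀ i j, s.2 i j = s.2 j i) (x y : Vec n) :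
    defect s x y = defect s y x := by
  rw [defect_apply, defect_apply, real_inner_comm, Finset.sum_comm]
  congr 1
  · ring
  · refine Finset.sum_congr rfl fun i _ => Finset.sum_congr rfl fun j _ => ?_
    rw [hs]; ring

lemma sum_defect_single {n : ℕ} (hn : n ≠ 0) {s : State n} (hs : SymmTraceZero s) :
    ∑ i, defect s (EuclideanSpace.single i 1) (EuclideanSpace.single i 1) = 2 - ‖s.1‖ ^ 2 := by
  simp only [defect_single, Finset.sum_add_distrib, hs.2, Finset.sum_sub_distrib]
  rw [EuclideanSpace.real_norm_sq_eq]
  simp [pow_two]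
  field_simp

lemma Admissible.defect_single_pos {n : ℕ} {s : State n} (ha : Admissible s) (i : Fin n) :
    0 < defect s (EuclideanSpace.single i 1) (EuclideanSpace.single i 1) :=
  ha _ (by simp)

lemma Admissible.norm_sq_lt {n : ℕ} (hn : n ≠ 0) {s : State n} (hs : SymmTraceZero s)
    (ha : Admissible s) : ‖s.1‖ ^ 2 < 2 := by
  have : NeZero n := ⟨hn⟩
  have := Finset.sum_pos (fun i _ => ha.defect_single_pos i) (Finset.univ_nonempty (α := Fin n))
  rw [sum_defect_single hn hs] at this
  linarith

/-- The diagonal entries of the defect matrix are positive with sum at most 2, so Cauchy–Schwarz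
bounds every entry by 2. The terms v_i v_j and 2/n contribute at most 2 each. This uniform bound is
what dominates the integrands in the passages to the limit. -/
lemma Admissible.abs_apply_le {n : ℕ} (hn : n ≠ 0) {s : State n} (hs : SymmTraceZero s)
    (ha : Admissible s) (i j : Fin n) : |s.2 i j| ≤ 6 := by
  have hle : ∀ i, defect s (EuclideanSpace.single i 1) (EuclideanSpace.single i 1) ≤ 2 := by
    intro i
    have := Finset.single_le_sum (fun i _ => (ha.defect_single_pos i).le) (Finset.mem_univ i)
    rw [sum_defect_single hn hs] at this
    linarith [sq_nonneg ‖s.1‖]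
  have hcs := LinearMap.BilinForm.apply_mul_apply_le_of_forall_zero_le (defect s)
    (fun x => by
      by_cases hx : x = 0
      · simp [hx]
      · exact (ha x hx).le) (EuclideanSpace.single i 1) (EuclideanSpace.single j 1)
  rw [defect_comm hs.1 (EuclideanSpace.single j 1)] at hcs
  have h4 : (defect s (EuclideanSpace.single i 1) (EuclideanSpace.single j 1)) ^ 2 ≤ 2 ^ 2 := by
    nlinarith [hle i, hle j, (ha.defect_single_pos i), (ha.defect_single_pos j)]
  have h5 := abs_le_of_sq_le_sq' h4 (by norm_num)
  rw [defect_single] at h5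
  have hv := ha.norm_sq_lt hn hs
  have hvi : ∀ k, s.1 k ^ 2 ≤ 2 := by
    intro k
    have := PiLp.norm_apply_le s.1 k
    rw [Real.norm_eq_abs] at this
    nlinarith [sq_abs (s.1 k), abs_nonneg (s.1 k)]
  have hvv : |s.1 i * s.1 j| ≤ 2 := by
    rw [abs_le]; constructor <;> nlinarith [hvi i, hvi j, sq_nonneg (s.1 i - s.1 j),
      sq_nonneg (s.1 i + s.1 j)]
  have h6 : 0 ≤ (if i = j then 2 / (n : ℝ) else 0) ∧ (if i = j then 2 / (n : ℝ) else 0) ≤ 2 := by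
    have : (1 : ℝ) ≤ n := by exact_mod_cast Nat.one_le_iff_ne_zero.mpr hn
    split_ifs
    · exact ⟨by positivity, div_le_self (by norm_num) this⟩
    · norm_num
  rw [abs_le] at hvv ⊢
  constructor <;> linarith [h5.1, h5.2, hvv.1, hvv.2, h6.1, h6.2]

/-- The set of eigenvalues is finite, so the supremum is attained, and positivity of the defect form
is tested on an eigenvector. An empty set would give the default supremum 0, which is harmless. -/
lemma Admissible.genEnergy_lt_one {n : ℕ} (hn : n ≠ 0) {s : State n} (ha : Admissible s)
    {u : SymTraceless n} (hu : ∀ i j, (u : Matrix (Fin n) (Fin n) ℝ) i j = s.2 i j) :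
    genEnergy s.1 u < 1 := by
  have hn' : (0 : ℝ) < n := by exact_mod_cast Nat.pos_of_ne_zero hn
  suffices h : lambdaMax (Matrix.vecMulVec (s.1 : Fin n → ℝ) (s.1 : Fin n → ℝ) -
      (u : Matrix (Fin n) (Fin n) ℝ)) < 2 / n by
    unfold genEnergy
    calc _ < (n : ℝ) / 2 * (2 / n) := by gcongr
      _ = 1 := by field_simp
  unfold lambdaMax
  set w := Matrix.vecMulVec (s.1 : Fin n → ℝ) (s.1 : Fin n → ℝ) -
      (u : Matrix (Fin n) (Fin n) ℝ) with hw
  have hfin : {μ : ℝ | Module.End.HasEigenvalue (Matrix.toLin' w) μ}.Finite :=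
    Module.End.finite_hasEigenvalue _
  rcases Set.eq_empty_or_nonempty {μ : ℝ | Module.End.HasEigenvalue (Matrix.toLin' w) μ} with h | h
  · rw [h, Real.sSup_empty]; positivity
  have hmem := h.csSup_mem hfin
  set μ := sSup {μ : ℝ | Module.End.HasEigenvalue (Matrix.toLin' w) μ}
  obtain ⟨x, hx⟩ := Module.End.HasEigenvalue.exists_hasEigenvector hmem
  have hx1 := hx.apply_eq_smul
  rw [Matrix.toLin'_apply] at hx1
  have hx0 : (WithLp.toLp 2 x : Vec n) ≠ 0 := by simpa using hx.2
  have hp := ha _ hx0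
  rw [defect_apply] at hp
  have hnorm : (0 : ℝ) < ∑ i, x i * x i := by
    have : 0 < ‖(WithLp.toLp 2 x : Vec n)‖ ^ 2 := by positivity
    rw [EuclideanSpace.real_norm_sq_eq] at this
    simpa [pow_two] using this
  have e1 : ∑ i, x i * (w.mulVec x) i = μ * ∑ i, x i * x i := by
    rw [hx1, Finset.mul_sum]
    exact Finset.sum_congr rfl fun i _ => by simp; ring
  have e2 : ∑ i, x i * (w.mulVec x) i = (∑ i, s.1 i * x i) * (∑ i, s.1 i * x i) -
      ∑ i, ∑ j, s.2 i j * (x i * x j) := by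
    rw [Finset.sum_mul_sum]
    simp only [hw, Matrix.mulVec, dotProduct, Matrix.sub_apply, Matrix.vecMulVec_apply, hu,
      Finset.mul_sum, ← Finset.sum_sub_distrib]
    exact Finset.sum_congr rfl fun i _ => Finset.sum_congr rfl fun j _ => by ring
  have e3 : inner ℝ s.1 (WithLp.toLp 2 x : Vec n) = ∑ i, s.1 i * x i := by
    simp [PiLp.inner_apply, mul_comm]
  have e4 : inner ℝ (WithLp.toLp 2 x : Vec n) (WithLp.toLp 2 x : Vec n) = ∑ i, x i * x i := by
    rw [real_inner_self_eq_norm_sq, EuclideanSpace.real_norm_sq_eq]; simp [pow_two]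
  rw [e3, e4] at hp
  simp only at hp
  have : μ * ∑ i, x i * x i < 2 / n * ∑ i, x i * x i := by
    rw [← e1, e2]; linarith
  exact lt_of_mul_lt_mul_right this hnorm.le

lemma continuous_defect {n : ℕ} : Continuous fun q : State n × Vec n => defect q.1 q.2 q.2 := by
  simp only [defect_apply]
  fun_prop

/-- By homogeneity, positivity need only be tested on the unit sphere, whose compactness makes it
stable in s. -/
lemma isOpen_admissible {n : ℕ} : IsOpen {s : State n | Admissible s} := by
  have heq : {s : State n | Admissible s} =
      {s | ∀ x ∈ Metric.sphere (0 : Vec n) 1, 0 < defect s x x} := by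
    ext s
    refine ⟨fun h x hx => h x (by rintro rfl; simp at hx), fun h x hx => ?_⟩
    have := h (‖x‖⁻¹ • x) (by simp [norm_smul, hx])
    simp only [map_smul, LinearMap.smul_apply, smul_eq_mul] at this
    have h0 : 0 < ‖x‖⁻¹ := by positivity
    exact pos_of_mul_pos_right (pos_of_mul_pos_right this h0.le) h0.le
  rw [heq, isOpen_iff_eventually]
  intro s hs
  refine (isCompact_sphere (0 : Vec n) 1).eventually_forall_of_forall_eventually fun x hx => ?_
  exact (continuous_defect.tendsto (s, x)).eventually (lt_mem_nhds (hs x hx))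

/-- A substitute for diagonalization. Choose a diagonal entry l = D_ii that is at least the average,
and let e be the normalized i-th row d of D. Cauchy–Schwarz for D gives ⟨d,x⟩² ≤ l D(x,x), and l ≤
‖d‖ turns this into the stated bound. -/
lemma exists_defect_direction {n : ℕ} (hn : n ≠ 0) {s : State n} (hs : SymmTraceZero s)
    (ha : Admissible s) :
    ∃ (e : Vec n) (l : ℝ), ‖e‖ = 1 ∧ (2 - ‖s.1‖ ^ 2) / n ≤ l ∧ l ≤ 2 ∧
      ∀ x, l * (inner ℝ e x) ^ 2 ≤ defect s x x := by
  have : NeZero n := ⟨hn⟩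
  have hn' : (0 : ℝ) < n := by exact_mod_cast Nat.pos_of_ne_zero hn
  have hpos : ∀ x, 0 ≤ defect s x x := fun x => by
    by_cases hx : x = 0
    · simp [hx]
    · exact (ha x hx).le
  obtain ⟨i, -, hi⟩ := Finset.exists_le_of_sum_le (s := (Finset.univ : Finset (Fin n)))
    (f := fun _ => (2 - ‖s.1‖ ^ 2) / n)
    (g := fun i => defect s (EuclideanSpace.single i 1) (EuclideanSpace.single i 1))
    Finset.univ_nonempty (by
      rw [sum_defect_single hn hs]; simp; field_simp; rfl)
  set l := defect s (EuclideanSpace.single i 1) (EuclideanSpace.single i 1) with hl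
  have hl0 : 0 < l := ha.defect_single_pos i
  have hl2 : l ≤ 2 := by
    have := Finset.single_le_sum (fun i _ => (ha.defect_single_pos i).le) (Finset.mem_univ i)
    rw [sum_defect_single hn hs] at this
    linarith [sq_nonneg ‖s.1‖]
  let d : Vec n := WithLp.toLp 2 fun j =>
    defect s (EuclideanSpace.single i 1) (EuclideanSpace.single j 1)
  have hd : ∀ x, inner ℝ d x = defect s (EuclideanSpace.single i 1) x := by
    intro x
    have hx : x = ∑ j, x j • (EuclideanSpace.single j 1 : Vec n) := by
      ext k; simp [Pi.single_apply]
    conv_rhs => rw [hx]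
    simp [PiLp.inner_apply, d]
  have hdl : l ≤ ‖d‖ := by
    have := PiLp.norm_apply_le d i
    exact (le_abs_self _).trans this
  have hd0 : 0 < ‖d‖ := hl0.trans_le hdl
  refine ⟨‖d‖⁻¹ • d, l, by simp [norm_smul, hd0.ne'], hi, hl2, fun x => ?_⟩
  have hcs := LinearMap.BilinForm.apply_mul_apply_le_of_forall_zero_le (defect s) hpos
    (EuclideanSpace.single i 1) x
  rw [defect_comm hs.1 x, ← hd, ← hl] at hcs
  rw [real_inner_smul_left]
  have : l * (‖d‖⁻¹ * inner ℝ d x) ^ 2 = l * (inner ℝ d x * inner ℝ d x) / ‖d‖ ^ 2 := by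
    field_simp
  rw [this, div_le_iff₀ (by positivity)]
  calc l * (inner ℝ d x * inner ℝ d x) ≤ l * (l * defect s x x) := by gcongr
    _ = defect s x x * l ^ 2 := by ring
    _ ≤ defect s x x * ‖d‖ ^ 2 := by
      have := hpos x
      gcongr

/-- The state `(e, m (e ⊗ ξ + ξ ⊗ e))`. -/
def waveState {n : ℕ} (e ξ : Vec n) (m : ℝ) : State n :=
  (e, fun i j => m * (e i * ξ j + ξ i * e j))

/-- Expanding (v + c e) ⊗ (v + c e) with v = a e + m ξ produces the mixed term c m (e ⊗ ξ + ξ ⊗ e),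
which the matrix part of the wave state cancels exactly. Only a multiple of e ⊗ e is left, and
`exists_defect_direction` controls it. -/
lemma defect_add_smul_waveState {n : ℕ} (s : State n) {e ξ : Vec n} {m a : ℝ}
    (hv : s.1 = a • e + m • ξ) (c : ℝ) (x : Vec n) :
    defect (s + c • waveState e ξ m) x x =
      defect s x x - (2 * c * a + c ^ 2) * (inner ℝ e x) ^ 2 := by
  have h1 : ∑ i, ∑ j, (s + c • waveState e ξ m).2 i j * (x i * x j) =
      ∑ i, ∑ j, s.2 i j * (x i * x j) + 2 * c * m * (inner ℝ e x * inner ℝ ξ x) := by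
    have : inner ℝ e x * inner ℝ ξ x = ∑ i, ∑ j, (e i * ξ j) * (x i * x j) := by
      simp only [PiLp.inner_apply, RCLike.inner_apply, conj_trivial, Finset.sum_mul_sum]
      exact Finset.sum_congr rfl fun i _ => Finset.sum_congr rfl fun j _ => by ring
    have h' : inner ℝ e x * inner ℝ ξ x = ∑ i, ∑ j, (ξ i * e j) * (x i * x j) := by
      rw [mul_comm (inner ℝ e x)]
      simp only [PiLp.inner_apply, RCLike.inner_apply, conj_trivial, Finset.sum_mul_sum]
      exact Finset.sum_congr rfl fun i _ => Finset.sum_congr rfl fun j _ => by ring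
    have h2 : 2 * c * m * (inner ℝ e x * inner ℝ ξ x) =
        c * m * (∑ i, ∑ j, (e i * ξ j) * (x i * x j)) +
          c * m * ∑ i, ∑ j, (ξ i * e j) * (x i * x j) := by
      rw [← this, ← h']; ring
    rw [h2]
    simp only [waveState, Finset.mul_sum, ← Finset.sum_add_distrib]
    exact Finset.sum_congr rfl fun i _ => Finset.sum_congr rfl fun j _ => by
      simp; ring
  rw [defect_apply, defect_apply, h1]
  simp only [waveState, Prod.fst_add, Prod.smul_fst, hv, inner_add_left, real_inner_smul_left]
  ring

lemma exists_admissible_segment {n : ℕ} (hn : 2 ≤ n) {s : State n} (hs : SymmTraceZero s)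
    (ha : Admissible s) :
    ∃ (e ξ : Vec n) (m d : ℝ), ‖e‖ = 1 ∧ ‖ξ‖ = 1 ∧ inner ℝ e ξ = 0 ∧
      (2 - ‖s.1‖ ^ 2) / (8 * n) ≤ d ∧
      ∀ c, |c| ≤ d → Admissible (s + c • waveState e ξ m) := by
  have hn0 : n ≠ 0 := by omega
  have hn' : (0 : ℝ) < n := by exact_mod_cast Nat.pos_of_ne_zero hn0
  have hv := ha.norm_sq_lt hn0 hs
  obtain ⟨e, l, he, hl, hl2, hle⟩ := exists_defect_direction hn0 hs ha
  have hl0 : 0 < l := lt_of_lt_of_le (div_pos (by linarith) hn') hl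
  have hee : inner ℝ e e = 1 := by rw [real_inner_self_eq_norm_sq, he]; norm_num
  obtain ⟨ξ, m, hξ, hξe, hdec⟩ : ∃ (ξ : Vec n) (m : ℝ), ‖ξ‖ = 1 ∧ inner ℝ e ξ = 0 ∧
      s.1 = (inner ℝ e s.1) • e + m • ξ := by
    -- If v is parallel to e, then m = 0 and any unit ξ orthogonal to e will do; it exists because n
    -- ≥ 2.
    by_cases h0 : s.1 - (inner ℝ e s.1) • e = 0
    · have : Nontrivial (ℝ ∙ e)ᗮ := by
        apply Module.nontrivial_of_finrank_pos (R := ℝ)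
        have h1 := Submodule.finrank_add_finrank_orthogonal (ℝ ∙ e)
        rw [finrank_span_singleton (by rintro rfl; simp at he), finrank_euclideanSpace_fin] at h1
        omega
      obtain ⟨ξ, hξ⟩ := exists_ne (0 : (ℝ ∙ e)ᗮ)
      have hξ0 : (ξ : Vec n) ≠ 0 := by simpa using hξ
      refine ⟨‖(ξ : Vec n)‖⁻¹ • (ξ : Vec n), 0, ?_, ?_, ?_⟩
      · simp [norm_smul, hξ0]
      · rw [real_inner_smul_right, Submodule.mem_orthogonal_singleton_iff_inner_right.mp ξ.2,
          mul_zero]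
      · rw [zero_smul, add_zero]; exact sub_eq_zero.mp h0
    · set y := s.1 - (inner ℝ e s.1) • e with hy
      refine ⟨‖y‖⁻¹ • y, ‖y‖, ?_, ?_, ?_⟩
      · simp [norm_smul, h0]
      · rw [real_inner_smul_right, hy, inner_sub_right, real_inner_smul_right, hee]; ring
      · rw [smul_smul, mul_inv_cancel₀ (by simpa using h0), one_smul, hy]; abel
  -- For |c| ≤ l/8, with |⟨e,v⟩| ≤ 2 and l ≤ 2, the loss 2c⟨e,v⟩ + c² is at most 3l/4, so a quarter
  -- of D(x,x) survives.
  refine ⟨e, ξ, m, l / 8, he, hξ, hξe, ?_, fun c hc x hx => ?_⟩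
  · rw [mul_comm, ← div_div]; gcongr
  rw [defect_add_smul_waveState s hdec]
  have hD := ha x hx
  have hDl := hle x
  have hal : |inner ℝ e s.1| ≤ 2 := by
    have := abs_real_inner_le_norm e s.1
    rw [he, one_mul] at this
    nlinarith [norm_nonneg s.1]
  have h1 : 2 * c * inner ℝ e s.1 + c ^ 2 ≤ 3 / 4 * l := by
    have h2 : c * inner ℝ e s.1 ≤ l / 8 * 2 := by
      calc c * inner ℝ e s.1 ≤ |c| * |inner ℝ e s.1| := by rw [← abs_mul]; exact le_abs_self _
        _ ≤ _ := by gcongr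
    have h3 : c ^ 2 ≤ (l / 8) ^ 2 := by
      rw [← sq_abs]; gcongr
    nlinarith
  have h2 : (2 * c * inner ℝ e s.1 + c ^ 2) * (inner ℝ e x) ^ 2 ≤
      3 / 4 * (l * (inner ℝ e x) ^ 2) := by
    calc _ ≤ (3 / 4 * l) * (inner ℝ e x) ^ 2 := by gcongr
      _ = _ := by ring
  linarith

/-! ### Directional derivatives of modulated amplitudes -/

section DirectionalDerivatives

variable {E : Type*} [NormedAddCommGroup E] [NormedSpace ℝ E]

/-- The derivative of a scalar function in a fixed direction. -/
def dirDeriv (a : E) (f : E → ℝ) : E → ℝ := fun p => fderiv ℝ f p a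

lemma _root_.ContDiff.dirDeriv {f : E → ℝ} (hf : ContDiff ℝ ∞ f) (a : E) :
    ContDiff ℝ ∞ (EulerSubsolution.dirDeriv a f) :=
  (hf.fderiv_right (m := ∞) (by simp)).clm_apply contDiff_const

lemma differentiable_of_smooth {F : Type*} [NormedAddCommGroup F] [NormedSpace ℝ F] {f : E → F}
    (hf : ContDiff ℝ ∞ f) : Differentiable ℝ f :=
  hf.differentiable (by simp)

lemma tsupport_dirDeriv_subset (a : E) (f : E → ℝ) :
    tsupport (dirDeriv a f) ⊆ tsupport f :=
  tsupport_fderiv_apply_subset ℝ a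

lemma dirDeriv_add {f g : E → ℝ} (hf : ContDiff ℝ ∞ f) (hg : ContDiff ℝ ∞ g) (a : E) :
    dirDeriv a (fun p => f p + g p) = fun p => dirDeriv a f p + dirDeriv a g p := by
  ext p
  simp only [dirDeriv]
  rw [fderiv_fun_add (differentiable_of_smooth hf p) (differentiable_of_smooth hg p)]
  rfl

lemma dirDeriv_sub {f g : E → ℝ} (hf : ContDiff ℝ ∞ f) (hg : ContDiff ℝ ∞ g) (a : E) :
    dirDeriv a (fun p => f p - g p) = fun p => dirDeriv a f p - dirDeriv a g p := by
  ext p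
  simp only [dirDeriv]
  rw [fderiv_fun_sub (differentiable_of_smooth hf p) (differentiable_of_smooth hg p)]
  rfl

lemma dirDeriv_const_mul {f : E → ℝ} (hf : ContDiff ℝ ∞ f) (c : ℝ) (a : E) :
    dirDeriv a (fun p => c * f p) = fun p => c * dirDeriv a f p := by
  ext p
  simp only [dirDeriv]
  rw [fderiv_const_mul (differentiable_of_smooth hf p)]
  rfl

lemma dirDeriv_mul_const {f : E → ℝ} (hf : ContDiff ℝ ∞ f) (c : ℝ) (a : E) :
    dirDeriv a (fun p => f p * c) = fun p => dirDeriv a f p * c := by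
  simp only [mul_comm _ c]
  exact dirDeriv_const_mul hf c a

lemma dirDeriv_comm {f : E → ℝ} (hf : ContDiff ℝ ∞ f) (a b : E) :
    dirDeriv a (dirDeriv b f) = dirDeriv b (dirDeriv a f) := by
  ext p
  have hs : IsSymmSndFDerivAt ℝ f p :=
    hf.contDiffAt.isSymmSndFDerivAt (by simp; exact WithTop.coe_le_coe.mpr le_top)
  have hd : DifferentiableAt ℝ (fderiv ℝ f) p :=
    differentiable_of_smooth (hf.fderiv_right (m := ∞) (by simp)) p
  have key : ∀ c d : E, dirDeriv c (dirDeriv d f) p = fderiv ℝ (fderiv ℝ f) p c d := by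
    intro c d
    unfold dirDeriv
    rw [fderiv_clm_apply hd (differentiableAt_const d)]
    simp
  rw [key, key, hs.eq]

/-- The iterated derivative in a list of directions, the first one being applied first. -/
def iterDirDeriv : List E → (E → ℝ) → E → ℝ
  | [], f => f
  | a :: l, f => iterDirDeriv l (dirDeriv a f)

lemma iterDirDeriv_add {f g : E → ℝ} (hf : ContDiff ℝ ∞ f) (hg : ContDiff ℝ ∞ g) (l : List E) :
    iterDirDeriv l (fun p => f p + g p) =
      fun p => iterDirDeriv l f p + iterDirDeriv l g p := by
  induction l generalizing f g with
  | nil => rfl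
  | cons a l ih => rw [iterDirDeriv, dirDeriv_add hf hg, ih (hf.dirDeriv a) (hg.dirDeriv a)]; rfl

lemma iterDirDeriv_const_mul {f : E → ℝ} (hf : ContDiff ℝ ∞ f) (c : ℝ) (l : List E) :
    iterDirDeriv l (fun p => c * f p) = fun p => c * iterDirDeriv l f p := by
  induction l generalizing f with
  | nil => rfl
  | cons a l ih => rw [iterDirDeriv, dirDeriv_const_mul hf, ih (hf.dirDeriv a)]; rfl

/-- The amplitude `χ` modulated by a plane wave of frequency `k` and phase shift `s`. -/
def modulated (χ : E → ℝ) (θ : E →L[ℝ] ℝ) (k s : ℝ) : E → ℝ :=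
  fun p => χ p * Real.cos (k * θ p + s)

lemma contDiff_modulated {χ : E → ℝ} (hχ : ContDiff ℝ ∞ χ) (θ : E →L[ℝ] ℝ) (k s : ℝ) :
    ContDiff ℝ ∞ (modulated χ θ k s) :=
  hχ.mul (Real.contDiff_cos.comp ((contDiff_const.mul θ.contDiff).add contDiff_const))

lemma tsupport_modulated_subset (χ : E → ℝ) (θ : E →L[ℝ] ℝ) (k s : ℝ) :
    tsupport (modulated χ θ k s) ⊆ tsupport χ :=
  tsupport_mul_subset_left

/-- Writing the derivative of the cosine as a phase shift by π/2 keeps both terms in the modulated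
family, which lets derivatives be iterated by induction. -/
lemma dirDeriv_modulated {χ : E → ℝ} (hχ : ContDiff ℝ ∞ χ) (θ : E →L[ℝ] ℝ) (k s : ℝ) (a : E) :
    dirDeriv a (modulated χ θ k s) = fun p => modulated (dirDeriv a χ) θ k s p +
      k * θ a * modulated χ θ k (s + Real.pi / 2) p := by
  ext p
  have h1 : HasFDerivAt χ (fderiv ℝ χ p) p := (differentiable_of_smooth hχ p).hasFDerivAt
  have h2 : HasFDerivAt (fun p => Real.cos (k * θ p + s))
      (-Real.sin (k * θ p + s) • (k • θ)) p :=
    ((θ.hasFDerivAt.const_mul k).add_const s).cos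
  have h3 := (h1.mul h2).fderiv
  have h4 : Real.cos (k * θ p + (s + Real.pi / 2)) = -Real.sin (k * θ p + s) := by
    rw [← add_assoc, Real.cos_add_pi_div_two]
  unfold modulated dirDeriv
  rw [h4]
  erw [h3]
  simp
  ring

/-- Each derivative costs at most one factor k. Uniformity in s matters because the phase shift is
chosen after k. -/
lemma exists_abs_iterDirDeriv_modulated_le (θ : E →L[ℝ] ℝ) (l : List E) {χ : E → ℝ}
    (hχ : ContDiff ℝ ∞ χ) (hc : HasCompactSupport χ) :
    ∃ C, ∀ k ≥ 1, ∀ s p, |iterDirDeriv l (modulated χ θ k s) p| ≤ C * k ^ l.length := by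
  induction l generalizing χ with
  | nil =>
    obtain ⟨C, hC⟩ := hc.exists_bound_of_continuous hχ.continuous
    refine ⟨C, fun k _ s p => ?_⟩
    simp only [iterDirDeriv, modulated, abs_mul, List.length_nil, pow_zero, mul_one]
    calc |χ p| * |Real.cos (k * θ p + s)| ≤ |χ p| * 1 := by
          gcongr; exact Real.abs_cos_le_one _
      _ ≤ C := by rw [mul_one]; exact hC p
  | cons a l ih =>
    obtain ⟨C₁, h₁⟩ := ih (hχ.dirDeriv a) (hc.mono' (subset_trans (subset_tsupport _)
      (tsupport_dirDeriv_subset a χ)))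
    obtain ⟨C₂, h₂⟩ := ih hχ hc
    refine ⟨C₁ + |θ a| * C₂, fun k hk s p => ?_⟩
    have hk0 : 0 ≤ k := by linarith
    rw [iterDirDeriv, dirDeriv_modulated hχ, iterDirDeriv_add (contDiff_modulated (hχ.dirDeriv a) ..)
      (contDiff_const.mul (contDiff_modulated hχ ..)),
      iterDirDeriv_const_mul (contDiff_modulated hχ ..)]
    have hC : 0 ≤ C₁ * k ^ l.length := (abs_nonneg _).trans (h₁ k hk s p)
    calc _ ≤ |iterDirDeriv l (modulated (dirDeriv a χ) θ k s) p| +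
          |k * θ a * iterDirDeriv l (modulated χ θ k (s + Real.pi / 2)) p| := abs_add_le _ _
      _ ≤ C₁ * k ^ l.length + k * |θ a| * (C₂ * k ^ l.length) := by
        rw [abs_mul, abs_mul, abs_of_nonneg hk0]
        gcongr
        · exact h₁ k hk s p
        · exact h₂ k hk _ p
      _ ≤ k * (C₁ * k ^ l.length) + k * |θ a| * (C₂ * k ^ l.length) := by
        have := le_mul_of_one_le_left hC hk
        linarith
      _ = _ := by rw [List.length_cons]; ring

/-- In the leading term every derivative falls on the cosine. Whenever one falls on χ instead, a
power of k is lost; the factor k on the left records this without an exponent `l.length - 1`. -/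
lemma exists_abs_iterDirDeriv_modulated_sub_le (θ : E →L[ℝ] ℝ) (l : List E) {χ : E → ℝ}
    (hχ : ContDiff ℝ ∞ χ) (hc : HasCompactSupport χ) :
    ∃ C, ∀ k ≥ 1, ∀ s p, k * |iterDirDeriv l (modulated χ θ k s) p -
      k ^ l.length * (l.map θ).prod * modulated χ θ k (s + l.length * (Real.pi / 2)) p| ≤
        C * k ^ l.length := by
  induction l with
  | nil => exact ⟨0, fun k _ s p => by simp [iterDirDeriv]⟩
  | cons a l ih =>
    obtain ⟨C₁, h₁⟩ := exists_abs_iterDirDeriv_modulated_le θ l (hχ.dirDeriv a)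
      (hc.mono' (subset_trans (subset_tsupport _) (tsupport_dirDeriv_subset a χ)))
    obtain ⟨C₂, h₂⟩ := ih
    refine ⟨C₁ + |θ a| * C₂, fun k hk s p => ?_⟩
    have hk0 : 0 ≤ k := by linarith
    rw [iterDirDeriv, dirDeriv_modulated hχ, iterDirDeriv_add (contDiff_modulated (hχ.dirDeriv a) ..)
      (contDiff_const.mul (contDiff_modulated hχ ..)),
      iterDirDeriv_const_mul (contDiff_modulated hχ ..)]
    have hs : s + ((a :: l).length : ℝ) * (Real.pi / 2) =
        s + Real.pi / 2 + l.length * (Real.pi / 2) := by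
      push_cast [List.length_cons]; ring
    rw [hs, List.length_cons, List.map_cons, List.prod_cons]
    set X := iterDirDeriv l (modulated (dirDeriv a χ) θ k s) p with hX
    set Y := iterDirDeriv l (modulated χ θ k (s + Real.pi / 2)) p with hY
    set Z := modulated χ θ k (s + Real.pi / 2 + l.length * (Real.pi / 2)) p with hZ
    have heq : X + k * θ a * Y - k ^ (l.length + 1) * (θ a * (l.map θ).prod) * Z =
        X + θ a * (k * (Y - k ^ l.length * (l.map θ).prod * Z)) := by ring
    rw [heq]
    calc _ ≤ k * (|X| + |θ a * (k * (Y - k ^ l.length * (l.map θ).prod * Z))|) := by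
          gcongr; exact abs_add_le _ _
      _ = k * |X| + k * (|θ a| * (k * |Y - k ^ l.length * (l.map θ).prod * Z|)) := by
        rw [abs_mul, abs_mul, abs_of_nonneg hk0]; ring
      _ ≤ k * (C₁ * k ^ l.length) + k * (|θ a| * (C₂ * k ^ l.length)) :=
        add_le_add (mul_le_mul_of_nonneg_left (h₁ k hk s p) hk0)
          (mul_le_mul_of_nonneg_left (mul_le_mul_of_nonneg_left (h₂ k hk _ p) (abs_nonneg _)) hk0)
      _ = _ := by ring

end DirectionalDerivatives

/-! ### Smooth flows -/

/-- Smooth compactly supported solutions `z = (v, u)` of `∂ₜ v + div u = 0`, `div v = 0`, with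
values in the symmetric traceless states. -/
structure IsFlow {n : ℕ} (z : Vec n × ℝ → State n) : Prop where
  contDiff : ContDiff ℝ ∞ z
  hasCompactSupport : HasCompactSupport z
  symmTraceZero : ∀ p, SymmTraceZero (z p)
  momentum : ∀ i p, dirDeriv (timeDir n) (fun p => (z p).1 i) p +
    ∑ j, dirDeriv (spaceDir j) (fun p => (z p).2 i j) p = 0
  divergence : ∀ p, ∑ i, dirDeriv (spaceDir i) (fun p => (z p).1 i) p = 0

lemma IsFlow.contDiff_fst {n : ℕ} {z : Vec n × ℝ → State n} (hz : IsFlow z) (i : Fin n) :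
    ContDiff ℝ ∞ fun p => (z p).1 i :=
  (contDiff_euclidean.mp (_root_.contDiff_fst.comp hz.contDiff)) i

lemma IsFlow.contDiff_snd {n : ℕ} {z : Vec n × ℝ → State n} (hz : IsFlow z) (i j : Fin n) :
    ContDiff ℝ ∞ fun p => (z p).2 i j :=
  contDiff_pi.mp (contDiff_pi.mp (_root_.contDiff_snd.comp hz.contDiff) i) j

lemma isFlow_zero (n : ℕ) : IsFlow (0 : Vec n × ℝ → State n) where
  contDiff := contDiff_zero_fun
  hasCompactSupport := HasCompactSupport.zero
  symmTraceZero p := ⟨fun _ _ => rfl, by simp⟩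
  momentum i p := by simp [dirDeriv]
  divergence p := by simp [dirDeriv]

lemma IsFlow.add {n : ℕ} {z w : Vec n × ℝ → State n} (hz : IsFlow z) (hw : IsFlow w) :
    IsFlow (z + w) where
  contDiff := hz.contDiff.add hw.contDiff
  hasCompactSupport := hz.hasCompactSupport.add hw.hasCompactSupport
  symmTraceZero p := ⟨fun i j => by
      simp [(hz.symmTraceZero p).1 i j, (hw.symmTraceZero p).1 i j], by
      simp [Finset.sum_add_distrib, (hz.symmTraceZero p).2, (hw.symmTraceZero p).2]⟩
  momentum i p := by
    simp only [Pi.add_apply, Prod.fst_add, Prod.snd_add, PiLp.add_apply,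
      dirDeriv_add (hz.contDiff_fst i) (hw.contDiff_fst i),
      dirDeriv_add (hz.contDiff_snd i _) (hw.contDiff_snd i _), Finset.sum_add_distrib]
    linarith [hz.momentum i p, hw.momentum i p]
  divergence p := by
    simp only [Pi.add_apply, Prod.fst_add, PiLp.add_apply,
      dirDeriv_add (hz.contDiff_fst _) (hw.contDiff_fst _), Finset.sum_add_distrib]
    linarith [hz.divergence p, hw.divergence p]

/-! ### Flows generated by a scalar potential in a plane -/

section PlanarFlow

variable {n : ℕ}

lemma sum_mul_dirDeriv_spaceDir (e : Vec n) (f : Vec n × ℝ → ℝ) (p : Vec n × ℝ) :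
    ∑ i, e i * dirDeriv (spaceDir i) f p = dirDeriv (e, 0) f p := by
  have he : ((e, 0) : Vec n × ℝ) = ∑ i, e i • spaceDir i := by
    have h1 : e = ∑ i, e i • (EuclideanSpace.single i 1 : Vec n) := by
      ext k; simp [Pi.single_apply]
    ext1
    · simpa [Prod.fst_sum, spaceDir] using h1
    · simp [Prod.snd_sum, spaceDir]
  rw [he]
  simp [dirDeriv]

/-- The Laplacian of `φ` in the plane spanned by `e` and `ξ`. -/
def planarLaplacian (e ξ : Vec n) (φ : Vec n × ℝ → ℝ) : Vec n × ℝ → ℝ := fun p =>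
  dirDeriv (e, 0) (dirDeriv (e, 0) φ) p + dirDeriv (ξ, 0) (dirDeriv (ξ, 0) φ) p

/-- The solution of the linear system with potential `φ`, in the plane spanned by `e` and `ξ`. -/
def planarFlow (e ξ : Vec n) (φ : Vec n × ℝ → ℝ) : Vec n × ℝ → State n := fun p =>
  (dirDeriv (ξ, 0) (planarLaplacian e ξ φ) p • e - dirDeriv (e, 0) (planarLaplacian e ξ φ) p • ξ,
    fun i j =>
      -2 * dirDeriv (timeDir n) (dirDeriv (e, 0) (dirDeriv (ξ, 0) φ)) p *
          (e i * e j - ξ i * ξ j) +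
        (dirDeriv (timeDir n) (dirDeriv (e, 0) (dirDeriv (e, 0) φ)) p -
          dirDeriv (timeDir n) (dirDeriv (ξ, 0) (dirDeriv (ξ, 0) φ)) p) *
          (e i * ξ j + ξ i * e j))

lemma contDiff_planarLaplacian (e ξ : Vec n) {φ : Vec n × ℝ → ℝ} (hφ : ContDiff ℝ ∞ φ) :
    ContDiff ℝ ∞ (planarLaplacian e ξ φ) :=
  ((hφ.dirDeriv _).dirDeriv _).add ((hφ.dirDeriv _).dirDeriv _)

lemma support_planarLaplacian_subset (e ξ : Vec n) (φ : Vec n × ℝ → ℝ) :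
    Function.support (planarLaplacian e ξ φ) ⊆ tsupport φ := by
  have h : ∀ a b : Vec n × ℝ, Function.support (dirDeriv a (dirDeriv b φ)) ⊆ tsupport φ :=
    fun a b => (subset_tsupport _).trans
      ((tsupport_dirDeriv_subset _ _).trans (tsupport_dirDeriv_subset _ _))
  exact (Function.support_add _ _).trans (union_subset (h _ _) (h _ _))

lemma support_planarFlow_subset (e ξ : Vec n) (φ : Vec n × ℝ → ℝ) :
    Function.support (planarFlow e ξ φ) ⊆ tsupport φ := by
  intro p hp
  by_contra h
  have h2 : ∀ a b c : Vec n × ℝ, dirDeriv a (dirDeriv b (dirDeriv c φ)) p = 0 := fun a b c =>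
    image_eq_zero_of_notMem_tsupport fun hq => h (tsupport_dirDeriv_subset _ _
      (tsupport_dirDeriv_subset _ _ (tsupport_dirDeriv_subset _ _ hq)))
  have h3 : ∀ a, dirDeriv a (planarLaplacian e ξ φ) p = 0 := fun a =>
    image_eq_zero_of_notMem_tsupport fun hq => h (closure_minimal
      (support_planarLaplacian_subset e ξ φ) (isClosed_tsupport _)
      (tsupport_dirDeriv_subset _ _ hq))
  refine hp ?_
  simp only [planarFlow, h2, h3]
  ext <;> simp

/-- Let A, B be the derivatives along e, ξ and S = (A² + B²)φ. The velocity (BS) e - (AS) ξ is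
divergence free because A and B commute. With P = -2∂ₜABφ and Q = ∂ₜ(A² - B²)φ, the components of
div u are AP + BQ = -∂ₜBS along e and AQ - BP = ∂ₜAS along ξ, which cancel ∂ₜv. Orthonormality of e
and ξ makes u trace free. -/
lemma isFlow_planarFlow {e ξ : Vec n} (he : ‖e‖ = 1) (hξ : ‖ξ‖ = 1) (heξ : inner ℝ e ξ = 0)
    {φ : Vec n × ℝ → ℝ} (hφ : ContDiff ℝ ∞ φ) (hc : HasCompactSupport φ) :
    IsFlow (planarFlow e ξ φ) := by
  set A : Vec n × ℝ := (e, 0) with hA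
  set B : Vec n × ℝ := (ξ, 0) with hB
  set τ : Vec n × ℝ := timeDir n with hτ
  have hS := contDiff_planarLaplacian e ξ hφ
  have h3 : ∀ a b c : Vec n × ℝ, ContDiff ℝ ∞ (dirDeriv a (dirDeriv b (dirDeriv c φ))) :=
    fun a b c => ((hφ.dirDeriv c).dirDeriv b).dirDeriv a
  have hSd : ∀ a, dirDeriv a (planarLaplacian e ξ φ) = fun p =>
      dirDeriv a (dirDeriv A (dirDeriv A φ)) p + dirDeriv a (dirDeriv B (dirDeriv B φ)) p :=
    fun a => dirDeriv_add ((hφ.dirDeriv _).dirDeriv _) ((hφ.dirDeriv _).dirDeriv _) a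
  have hv : ∀ i, (fun p => (planarFlow e ξ φ p).1 i) = fun p =>
      dirDeriv B (planarLaplacian e ξ φ) p * e i - dirDeriv A (planarLaplacian e ξ φ) p * ξ i := by
    intro i; ext p; simp [planarFlow, hA, hB]
  have hvd : ∀ i a, dirDeriv a (fun p => (planarFlow e ξ φ p).1 i) = fun p =>
      dirDeriv a (dirDeriv B (planarLaplacian e ξ φ)) p * e i -
        dirDeriv a (dirDeriv A (planarLaplacian e ξ φ)) p * ξ i := by
    intro i a
    rw [hv, dirDeriv_sub ((hS.dirDeriv _).mul contDiff_const) ((hS.dirDeriv _).mul contDiff_const),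
      dirDeriv_mul_const (hS.dirDeriv _), dirDeriv_mul_const (hS.dirDeriv _)]
  set P : Vec n × ℝ → ℝ := fun p => -2 * dirDeriv τ (dirDeriv A (dirDeriv B φ)) p with hP
  set Q : Vec n × ℝ → ℝ := fun p => dirDeriv τ (dirDeriv A (dirDeriv A φ)) p -
    dirDeriv τ (dirDeriv B (dirDeriv B φ)) p with hQ
  have hPc : ContDiff ℝ ∞ P := contDiff_const.mul (h3 _ _ _)
  have hQc : ContDiff ℝ ∞ Q := (h3 _ _ _).sub (h3 _ _ _)
  have hu : ∀ i j, (fun p => (planarFlow e ξ φ p).2 i j) = fun p =>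
      P p * (e i * e j - ξ i * ξ j) + Q p * (e i * ξ j + ξ i * e j) := fun i j => rfl
  have hud : ∀ i j a, dirDeriv a (fun p => (planarFlow e ξ φ p).2 i j) = fun p =>
      dirDeriv a P p * (e i * e j - ξ i * ξ j) + dirDeriv a Q p * (e i * ξ j + ξ i * e j) := by
    intro i j a
    rw [hu, dirDeriv_add (hPc.mul contDiff_const) (hQc.mul contDiff_const),
      dirDeriv_mul_const hPc, dirDeriv_mul_const hQc]
  refine ⟨?_, ?_, ?_, ?_, ?_⟩
  · refine ContDiff.prodMk (((hS.dirDeriv _).smul contDiff_const).sub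
      ((hS.dirDeriv _).smul contDiff_const)) ?_
    refine contDiff_pi.mpr fun i => contDiff_pi.mpr fun j => ?_
    exact (hPc.mul contDiff_const).add (hQc.mul contDiff_const)
  · exact hc.mono' (support_planarFlow_subset e ξ φ)
  · intro p
    refine ⟨fun i j => by simp only [planarFlow]; ring, ?_⟩
    have h1 : ∑ i, (e i * e i - ξ i * ξ i) = 0 := by
      have h1 := EuclideanSpace.real_norm_sq_eq e
      have h2 := EuclideanSpace.real_norm_sq_eq ξ
      rw [Finset.sum_sub_distrib]
      simp only [← pow_two]
      rw [← h1, ← h2, he, hξ]; simp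
    have h2 : ∑ i, (e i * ξ i + ξ i * e i) = 0 := by
      have : ∑ i, e i * ξ i = 0 := by
        rw [← heξ]; simp [PiLp.inner_apply, mul_comm]
      rw [Finset.sum_add_distrib, this, zero_add, ← this]
      exact Finset.sum_congr rfl fun i _ => mul_comm _ _
    simp only [planarFlow, Finset.sum_add_distrib, ← Finset.mul_sum] at h2 ⊢
    rw [h1, h2]; simp
  · intro i p
    simp only [hvd, hud]
    have hsum : ∑ j, (dirDeriv (spaceDir j) P p * (e i * e j - ξ i * ξ j) +
        dirDeriv (spaceDir j) Q p * (e i * ξ j + ξ i * e j)) =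
        e i * dirDeriv A P p - ξ i * dirDeriv B P p + e i * dirDeriv B Q p +
          ξ i * dirDeriv A Q p := by
      rw [hA, hB, ← sum_mul_dirDeriv_spaceDir e P, ← sum_mul_dirDeriv_spaceDir ξ P,
        ← sum_mul_dirDeriv_spaceDir ξ Q, ← sum_mul_dirDeriv_spaceDir e Q]
      simp only [Finset.mul_sum, ← Finset.sum_add_distrib, ← Finset.sum_sub_distrib]
      exact Finset.sum_congr rfl fun j _ => by ring
    rw [hsum]
    have hPd : ∀ a, dirDeriv a P p = -2 * dirDeriv τ (dirDeriv a (dirDeriv A (dirDeriv B φ))) p := by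
      intro a
      rw [hP, dirDeriv_const_mul (h3 _ _ _), dirDeriv_comm ((hφ.dirDeriv _).dirDeriv _) a τ]
    have hQd : ∀ a, dirDeriv a Q p = dirDeriv τ (dirDeriv a (dirDeriv A (dirDeriv A φ))) p -
        dirDeriv τ (dirDeriv a (dirDeriv B (dirDeriv B φ))) p := by
      intro a
      rw [hQ, dirDeriv_sub (h3 _ _ _) (h3 _ _ _),
        dirDeriv_comm ((hφ.dirDeriv _).dirDeriv _) a τ,
        dirDeriv_comm ((hφ.dirDeriv _).dirDeriv _) a τ]
    have hAAB : dirDeriv A (dirDeriv A (dirDeriv B φ)) = dirDeriv B (dirDeriv A (dirDeriv A φ)) := by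
      rw [dirDeriv_comm hφ A B, dirDeriv_comm (hφ.dirDeriv _) A B]
    have hBAB : dirDeriv B (dirDeriv A (dirDeriv B φ)) = dirDeriv A (dirDeriv B (dirDeriv B φ)) :=
      dirDeriv_comm (hφ.dirDeriv _) B A
    simp only [hPd, hQd, hSd, dirDeriv_add (h3 _ _ _) (h3 _ _ _), hAAB, hBAB]
    ring
  · intro p
    simp only [hvd, Finset.sum_sub_distrib, mul_comm _ (e _), mul_comm _ (ξ _)]
    rw [sum_mul_dirDeriv_spaceDir, sum_mul_dirDeriv_spaceDir, dirDeriv_comm hS, sub_self]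

/-- The phase `⟨ξ, x⟩ - m t`. -/
def phase (ξ : Vec n) (m : ℝ) : Vec n × ℝ →L[ℝ] ℝ :=
  (innerSL ℝ ξ).comp (ContinuousLinearMap.fst ℝ _ _) - m • ContinuousLinearMap.snd ℝ _ _

lemma phase_apply (ξ : Vec n) (m : ℝ) (p : Vec n × ℝ) :
    phase ξ m p = inner ℝ ξ p.1 - m * p.2 := by
  simp [phase]

/-- The potential of an oscillating flow of frequency `k`. -/
def wavePotential (ξ : Vec n) (m : ℝ) (χ : Vec n × ℝ → ℝ) (k s : ℝ) : Vec n × ℝ → ℝ :=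
  fun p => (k ^ 3)⁻¹ * modulated χ (phase ξ m) k (s - 3 * (Real.pi / 2)) p

lemma contDiff_wavePotential (ξ : Vec n) (m : ℝ) {χ : Vec n × ℝ → ℝ} (hχ : ContDiff ℝ ∞ χ)
    (k s : ℝ) : ContDiff ℝ ∞ (wavePotential ξ m χ k s) :=
  contDiff_const.mul (contDiff_modulated hχ ..)

lemma tsupport_wavePotential_subset (ξ : Vec n) (m : ℝ) (χ : Vec n × ℝ → ℝ) (k s : ℝ) :
    tsupport (wavePotential ξ m χ k s) ⊆ tsupport χ :=
  tsupport_mul_subset_right.trans (tsupport_modulated_subset _ _ _ _)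

lemma exists_abs_dirDeriv_wavePotential_le (ξ : Vec n) (m : ℝ) {χ : Vec n × ℝ → ℝ}
    (hχ : ContDiff ℝ ∞ χ) (hc : HasCompactSupport χ) (a b : Vec n × ℝ) :
    ∃ C, ∀ k ≥ 1, ∀ s p, |dirDeriv a (dirDeriv b (wavePotential ξ m χ k s)) p| ≤ C / k := by
  obtain ⟨C, hC⟩ := exists_abs_iterDirDeriv_modulated_le (phase ξ m) [b, a] hχ hc
  refine ⟨C, fun k hk s p => ?_⟩
  have hk0 : 0 < k := by linarith
  have h := hC k hk (s - 3 * (Real.pi / 2)) p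
  change |iterDirDeriv [b, a] _ p| ≤ _
  unfold wavePotential
  rw [iterDirDeriv_const_mul (contDiff_modulated hχ ..), abs_mul, abs_of_pos (by positivity)]
  calc _ ≤ (k ^ 3)⁻¹ * (C * k ^ 2) := by gcongr; exact h
    _ = _ := by field_simp

/-- The factor k⁻³ and the shift -3π/2 in the potential are undone exactly by three derivatives
falling on the phase. -/
lemma exists_abs_dirDeriv_wavePotential_sub_le (ξ : Vec n) (m : ℝ) {χ : Vec n × ℝ → ℝ}
    (hχ : ContDiff ℝ ∞ χ) (hc : HasCompactSupport χ) (a b c : Vec n × ℝ) :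
    ∃ C, ∀ k ≥ 1, ∀ s p, |dirDeriv a (dirDeriv b (dirDeriv c (wavePotential ξ m χ k s))) p -
      phase ξ m a * phase ξ m b * phase ξ m c * modulated χ (phase ξ m) k s p| ≤ C / k := by
  obtain ⟨C, hC⟩ := exists_abs_iterDirDeriv_modulated_sub_le (phase ξ m) [c, b, a] hχ hc
  refine ⟨C, fun k hk s p => ?_⟩
  have hk0 : 0 < k := by linarith
  have h := hC k hk (s - 3 * (Real.pi / 2)) p
  simp only [List.length_cons, List.length_nil, List.map_cons, List.map_nil, List.prod_cons,
    List.prod_nil, mul_one] at h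
  push_cast at h
  norm_num at h
  change |iterDirDeriv [c, b, a] _ p - _| ≤ _
  unfold wavePotential
  rw [iterDirDeriv_const_mul (contDiff_modulated hχ ..)]
  set X := iterDirDeriv [c, b, a] (modulated χ (phase ξ m) k (s - 3 * (Real.pi / 2))) p
  set Y := modulated χ (phase ξ m) k s p
  rw [le_div_iff₀ hk0]
  have heq : (k ^ 3)⁻¹ * X - phase ξ m a * phase ξ m b * phase ξ m c * Y =
      (k ^ 3)⁻¹ * (X - k ^ 3 * (phase ξ m c * (phase ξ m b * phase ξ m a)) * Y) := by
    field_simp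
  rw [heq, abs_mul, abs_of_pos (by positivity)]
  calc _ = (k ^ 3)⁻¹ * (k * |X - k ^ 3 * (phase ξ m c * (phase ξ m b * phase ξ m a)) * Y|) := by
        ring
    _ ≤ (k ^ 3)⁻¹ * (C * k ^ 3) := by gcongr
    _ = C := by field_simp

end PlanarFlow

/-! ### Closeness to plane waves and weak smallness -/

section

section Slices

variable {X F : Type*} [TopologicalSpace X] [T2Space X] [Zero F]

lemma hasCompactSupport_slice {z : X × ℝ → F} (hz : HasCompactSupport z) (t : ℝ) :
    HasCompactSupport fun x => z (x, t) := by
  refine HasCompactSupport.intro (hz.isCompact.image continuous_fst) fun x hx => ?_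
  exact image_eq_zero_of_notMem_tsupport fun h => hx ⟨(x, t), h, rfl⟩

end Slices

variable {n : ℕ}

lemma norm_apply_le_one {e : Vec n} (he : ‖e‖ = 1) (i : Fin n) : |e i| ≤ 1 := by
  have := PiLp.norm_apply_le e i
  rwa [he] at this

/-- The phase has derivative 0 along e, 1 along ξ and -m along time. So among the third derivatives
that occur, only ∂_ξ³ and ∂ₜ∂_ξ² have a nonzero leading term, and these assemble to the wave state.
The second bound has only two derivatives against k⁻³ and serves the weak estimate. -/
lemma exists_norm_planarFlow_sub_le {e ξ : Vec n} (he : ‖e‖ = 1) (hξ : ‖ξ‖ = 1)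
    (heξ : inner ℝ e ξ = 0) (m : ℝ) {χ : Vec n × ℝ → ℝ} (hχ : ContDiff ℝ ∞ χ)
    (hc : HasCompactSupport χ) :
    ∃ C, ∀ k ≥ 1, ∀ s p, ‖planarFlow e ξ (wavePotential ξ m χ k s) p -
        modulated χ (phase ξ m) k s p • waveState e ξ m‖ ≤ C / k ∧
      |planarLaplacian e ξ (wavePotential ξ m χ k s) p| ≤ C / k := by
  have hA : phase ξ m (e, 0) = 0 := by simp [phase_apply, real_inner_comm, heξ]
  have hB : phase ξ m (ξ, 0) = 1 := by simp [phase_apply, hξ]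
  have hτ : phase ξ m (timeDir n) = -m := by simp [phase_apply, timeDir]
  have H := exists_abs_dirDeriv_wavePotential_sub_le ξ m hχ hc
  have H2 := exists_abs_dirDeriv_wavePotential_le ξ m hχ hc
  obtain ⟨C₁, h₁⟩ := H (ξ, 0) (ξ, 0) (ξ, 0)
  obtain ⟨C₂, h₂⟩ := H (ξ, 0) (e, 0) (e, 0)
  obtain ⟨C₃, h₃⟩ := H (e, 0) (e, 0) (e, 0)
  obtain ⟨C₄, h₄⟩ := H (e, 0) (ξ, 0) (ξ, 0)
  obtain ⟨C₅, h₅⟩ := H (timeDir n) (e, 0) (ξ, 0)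
  obtain ⟨C₆, h₆⟩ := H (timeDir n) (e, 0) (e, 0)
  obtain ⟨C₇, h₇⟩ := H (timeDir n) (ξ, 0) (ξ, 0)
  obtain ⟨C₈, h₈⟩ := H2 (e, 0) (e, 0)
  obtain ⟨C₉, h₉⟩ := H2 (ξ, 0) (ξ, 0)
  simp only [hA, hB, hτ, zero_mul, mul_zero, one_mul, mul_one, sub_zero] at h₁ h₂ h₃ h₄ h₅ h₆ h₇
  refine ⟨4 * (C₁ + C₂ + C₃ + C₄ + C₅ + C₆ + C₇ + C₈ + C₉), fun k hk s p => ?_⟩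
  specialize h₁ k hk s p
  specialize h₂ k hk s p
  specialize h₃ k hk s p
  specialize h₄ k hk s p
  specialize h₅ k hk s p
  specialize h₆ k hk s p
  specialize h₇ k hk s p
  specialize h₈ k hk s p
  specialize h₉ k hk s p
  have hφ := contDiff_wavePotential ξ m hχ k s
  set φ := wavePotential ξ m χ k s
  set M := modulated χ (phase ξ m) k s p
  have hsplit : 4 * (C₁ + C₂ + C₃ + C₄ + C₅ + C₆ + C₇ + C₈ + C₉) / k =
      4 * (C₁ / k + C₂ / k + C₃ / k + C₄ / k + C₅ / k + C₆ / k + C₇ / k + C₈ / k + C₉ / k) := by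
    ring
  rw [hsplit]
  have g₁ := (abs_nonneg _).trans h₁
  have g₂ := (abs_nonneg _).trans h₂
  have g₃ := (abs_nonneg _).trans h₃
  have g₄ := (abs_nonneg _).trans h₄
  have g₅ := (abs_nonneg _).trans h₅
  have g₆ := (abs_nonneg _).trans h₆
  have g₇ := (abs_nonneg _).trans h₇
  have g₈ := (abs_nonneg _).trans h₈
  have g₉ := (abs_nonneg _).trans h₉
  have hS : ∀ a, dirDeriv a (planarLaplacian e ξ φ) p =
      dirDeriv a (dirDeriv (e, 0) (dirDeriv (e, 0) φ)) p +
        dirDeriv a (dirDeriv (ξ, 0) (dirDeriv (ξ, 0) φ)) p := fun a => by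
    unfold planarLaplacian
    rw [dirDeriv_add ((hφ.dirDeriv _).dirDeriv _) ((hφ.dirDeriv _).dirDeriv _)]
  constructor
  · rw [Prod.norm_def]
    refine max_le ?_ ?_
    · simp only [planarFlow, waveState, Prod.fst_sub, Prod.smul_fst, hS]
      generalize dirDeriv (ξ, 0) (dirDeriv (e, 0) (dirDeriv (e, 0) φ)) p = a₂ at *
      generalize dirDeriv (ξ, 0) (dirDeriv (ξ, 0) (dirDeriv (ξ, 0) φ)) p = a₁ at *
      generalize dirDeriv (e, 0) (dirDeriv (e, 0) (dirDeriv (e, 0) φ)) p = a₃ at *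
      generalize dirDeriv (e, 0) (dirDeriv (ξ, 0) (dirDeriv (ξ, 0) φ)) p = a₄ at *
      have : (a₂ + a₁) • e - (a₃ + a₄) • ξ - M • e = (a₂ + (a₁ - M)) • e - (a₃ + a₄) • ξ := by
        module
      rw [this]
      refine (norm_sub_le _ _).trans ?_
      rw [norm_smul, norm_smul, he, hξ, mul_one, mul_one, Real.norm_eq_abs, Real.norm_eq_abs]
      linarith [abs_add_le a₂ (a₁ - M), abs_add_le a₃ a₄]
    · refine (pi_norm_le_iff_of_nonneg (by linarith)).mpr fun i =>
        (pi_norm_le_iff_of_nonneg (by linarith)).mpr fun j => ?_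
      simp only [planarFlow, waveState, Prod.snd_sub, Prod.smul_snd, Pi.sub_apply, Pi.smul_apply,
        smul_eq_mul, Real.norm_eq_abs]
      generalize dirDeriv (timeDir n) (dirDeriv (e, 0) (dirDeriv (ξ, 0) φ)) p = a₅ at *
      generalize dirDeriv (timeDir n) (dirDeriv (e, 0) (dirDeriv (e, 0) φ)) p = a₆ at *
      generalize dirDeriv (timeDir n) (dirDeriv (ξ, 0) (dirDeriv (ξ, 0) φ)) p = a₇ at *
      have hprod : ∀ a b : ℝ, |a| ≤ 1 → |b| ≤ 1 → |a * b| ≤ 1 := fun a b ha hb => by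
        rw [abs_mul]; exact mul_le_one₀ ha (abs_nonneg _) hb
      have hei := norm_apply_le_one he
      have hξi := norm_apply_le_one hξ
      have c₁ : |e i * e j - ξ i * ξ j| ≤ 2 := (abs_sub _ _).trans (by
        linarith [hprod _ _ (hei i) (hei j), hprod _ _ (hξi i) (hξi j)])
      have c₂ : |e i * ξ j + ξ i * e j| ≤ 2 := (abs_add_le _ _).trans (by
        linarith [hprod _ _ (hei i) (hξi j), hprod _ _ (hξi i) (hei j)])
      generalize e i * e j - ξ i * ξ j = b₁ at *
      generalize e i * ξ j + ξ i * e j = b₂ at *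
      have : -2 * a₅ * b₁ + (a₆ - a₇) * b₂ - M * (m * b₂) =
          -2 * (a₅ * b₁) + (a₆ * b₂ - (a₇ - -m * M) * b₂) := by ring
      rw [this]
      have d₁ : |a₅ * b₁| ≤ C₅ / k * 2 := by rw [abs_mul]; gcongr
      have d₂ : |a₆ * b₂| ≤ C₆ / k * 2 := by rw [abs_mul]; gcongr
      have d₃ : |(a₇ - -m * M) * b₂| ≤ C₇ / k * 2 := by rw [abs_mul]; gcongr
      rw [abs_le] at d₁ d₂ d₃ ⊢
      constructor <;> linarith [d₁.1, d₁.2, d₂.1, d₂.2, d₃.1, d₃.2]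
  · unfold planarLaplacian
    exact (abs_add_le _ _).trans (by linarith)

/-- The time slices of the velocity of `w` are small, in a negative Sobolev sense. -/
def WeaklySmall (w : Vec n × ℝ → State n) (η : ℝ) : Prop :=
  ∀ g : Vec n → Vec n, ContDiff ℝ ∞ g → HasCompactSupport g → ∀ t,
    |∫ x, inner ℝ (w (x, t)).1 (g x)| ≤ η * ∫ x, ‖fderiv ℝ g x‖

lemma dirDeriv_slice {f : Vec n × ℝ → ℝ} (hf : ContDiff ℝ ∞ f) (a x : Vec n) (t : ℝ) :
    fderiv ℝ (fun y => f (y, t)) x a = dirDeriv (a, 0) f (x, t) := by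
  have h1 : HasFDerivAt f (fderiv ℝ f (x, t)) (x, t) :=
    (differentiable_of_smooth hf _).hasFDerivAt
  have h2 : HasFDerivAt (fun y : Vec n => (y, t)) (ContinuousLinearMap.inl ℝ (Vec n) ℝ) x :=
    hasFDerivAt_prodMk_left x t
  have := (h1.comp x h2).fderiv
  simp only [Function.comp_def] at this
  rw [this]
  simp [dirDeriv]

lemma abs_integral_dirDeriv_mul_le {S : Vec n → ℝ} (hS : ContDiff ℝ ∞ S)
    (hSc : HasCompactSupport S) {ε : ℝ} (hε : ∀ x, |S x| ≤ ε) {g : Vec n → Vec n}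
    (hg : ContDiff ℝ ∞ g) (hgc : HasCompactSupport g) {a b : Vec n} (ha : ‖a‖ = 1)
    (hb : ‖b‖ = 1) :
    |∫ x, fderiv ℝ S x a * inner ℝ b (g x)| ≤ ε * ∫ x, ‖fderiv ℝ g x‖ := by
  have hgb : ContDiff ℝ ∞ fun x => inner ℝ b (g x) := contDiff_const.inner ℝ hg
  have hdS : Continuous fun x => fderiv ℝ S x a := (hS.dirDeriv a).continuous
  have hdg : Continuous fun x => fderiv ℝ (fun x => inner ℝ b (g x)) x a :=
    (hgb.dirDeriv a).continuous
  have hfg : Continuous fun x => fderiv ℝ g x :=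
    (hg.fderiv_right (m := ∞) (by simp)).continuous
  have h1 := integral_mul_fderiv_eq_neg_fderiv_mul_of_integrable (μ := (volume : Measure (Vec n)))
    (f := S) (g := fun x => inner ℝ b (g x)) (v := a)
    ((hdS.mul hgb.continuous).integrable_of_hasCompactSupport
      (HasCompactSupport.mul_right (hSc.fderiv_apply ℝ a)))
    ((hS.continuous.mul hdg).integrable_of_hasCompactSupport (HasCompactSupport.mul_right hSc))
    ((hS.continuous.mul hgb.continuous).integrable_of_hasCompactSupport
      (HasCompactSupport.mul_right hSc))
    (fun x _ => differentiable_of_smooth hS x) (fun x _ => differentiable_of_smooth hgb x)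
  have h2 : |∫ x, fderiv ℝ S x a * inner ℝ b (g x)| =
      |∫ x, S x * fderiv ℝ (fun x => inner ℝ b (g x)) x a| := by rw [h1, abs_neg]
  rw [h2, ← integral_const_mul]
  have hε0 : 0 ≤ ε := (abs_nonneg _).trans (hε 0)
  refine norm_integral_le_of_norm_le (f := fun x => S x * fderiv ℝ (fun x => inner ℝ b (g x)) x a)
    ((continuous_const.mul hfg.norm).integrable_of_hasCompactSupport
    (HasCompactSupport.mul_left (hgc.fderiv ℝ).norm)) (Filter.Eventually.of_forall fun x => ?_)
  rw [fderiv_inner_apply ℝ (differentiableAt_const b) (differentiable_of_smooth hg x)]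
  simp only [fderiv_fun_const, Pi.zero_apply, zero_apply, inner_zero_left,
    add_zero, norm_mul]
  have h3 : ‖inner ℝ b (fderiv ℝ g x a)‖ ≤ ‖fderiv ℝ g x‖ := by
    calc _ ≤ ‖b‖ * ‖fderiv ℝ g x a‖ := norm_inner_le_norm _ _
      _ ≤ 1 * (‖fderiv ℝ g x‖ * ‖a‖) := by rw [hb]; gcongr; exact ContinuousLinearMap.le_opNorm _ _
      _ = _ := by rw [ha]; ring
  exact mul_le_mul (hε x) h3 (norm_nonneg _) hε0

/-- On each time slice the velocity consists of two first derivatives of the planar Laplacian of φ.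
Integrating by parts moves each derivative onto the test field, at cost ε per term. -/
lemma weaklySmall_planarFlow {e ξ : Vec n} (he : ‖e‖ = 1) (hξ : ‖ξ‖ = 1)
    {φ : Vec n × ℝ → ℝ} (hφ : ContDiff ℝ ∞ φ) (hc : HasCompactSupport φ) {ε : ℝ}
    (hε : ∀ p, |planarLaplacian e ξ φ p| ≤ ε) :
    WeaklySmall (planarFlow e ξ φ) (2 * ε) := by
  intro g hg hgc t
  have hS := contDiff_planarLaplacian e ξ hφ
  have hSc : HasCompactSupport (planarLaplacian e ξ φ) :=
    hc.mono' (support_planarLaplacian_subset e ξ φ)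
  have hSt : ContDiff ℝ ∞ fun x => planarLaplacian e ξ φ (x, t) :=
    hS.comp (contDiff_id.prodMk contDiff_const)
  have hStc := hasCompactSupport_slice hSc t
  have hint : ∀ a b : Vec n, Integrable fun x =>
      fderiv ℝ (fun x => planarLaplacian e ξ φ (x, t)) x a * inner ℝ b (g x) := fun a b =>
    ((hSt.dirDeriv a).continuous.mul (contDiff_const.inner ℝ hg).continuous
      ).integrable_of_hasCompactSupport (HasCompactSupport.mul_right (hStc.fderiv_apply ℝ a))
  have heq : ∀ x, inner ℝ (planarFlow e ξ φ (x, t)).1 (g x) =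
      fderiv ℝ (fun x => planarLaplacian e ξ φ (x, t)) x ξ * inner ℝ e (g x) -
        fderiv ℝ (fun x => planarLaplacian e ξ φ (x, t)) x e * inner ℝ ξ (g x) := by
    intro x
    rw [dirDeriv_slice hS, dirDeriv_slice hS]
    simp [planarFlow, inner_sub_left, real_inner_smul_left]
  simp only [heq]
  rw [integral_sub (hint _ _) (hint _ _)]
  refine (abs_sub _ _).trans ?_
  have h1 := abs_integral_dirDeriv_mul_le hSt hStc (fun x => hε (x, t)) hg hgc hξ he
  have h2 := abs_integral_dirDeriv_mul_le hSt hStc (fun x => hε (x, t)) hg hgc he hξ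
  linarith

end

/-! ### Localized perturbations with a definite energy gain -/

section

variable {n : ℕ}

/-- The constant in the lower bound for the energy of the localized perturbations. -/
def energyGain (n : ℕ) : ℝ := 1 / (512 * (n : ℝ) ^ 2 * 2 ^ n)

lemma energyGain_pos (hn : n ≠ 0) : 0 < energyGain n := by
  have : (0 : ℝ) < n := by exact_mod_cast Nat.pos_of_ne_zero hn
  unfold energyGain
  positivity

lemma IsFlow.contDiff_slice {z : Vec n × ℝ → State n} (hz : IsFlow z) (t : ℝ) :
    ContDiff ℝ ∞ fun x => (z (x, t)).1 :=
  _root_.contDiff_fst.comp (hz.contDiff.comp (contDiff_id.prodMk contDiff_const))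

lemma IsFlow.hasCompactSupport_slice {z : Vec n × ℝ → State n} (hz : IsFlow z) (t : ℝ) :
    HasCompactSupport fun x => (z (x, t)).1 :=
  (EulerSubsolution.hasCompactSupport_slice hz.hasCompactSupport t).comp_left (g := Prod.fst) rfl

lemma IsFlow.integrable_norm_sq {z : Vec n × ℝ → State n} (hz : IsFlow z) (t : ℝ) :
    Integrable fun x => ‖(z (x, t)).1‖ ^ 2 :=
  Continuous.integrable_of_hasCompactSupport (by
      have := (hz.contDiff_slice t).continuous
      fun_prop)
    (HasCompactSupport.comp_left (g := fun v : Vec n => ‖v‖ ^ 2) (hz.hasCompactSupport_slice t)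
      (by simp))

lemma IsFlow.integrable_inner {z : Vec n × ℝ → State n} (hz : IsFlow z) (t : ℝ)
    {g : Vec n → Vec n} (hg : Continuous g) :
    Integrable fun x => (inner ℝ (z (x, t)).1 (g x) : ℝ) := by
  have hv : Continuous fun x => (z (x, t)).1 := (hz.contDiff_slice t).continuous
  have hc := hz.hasCompactSupport_slice t
  have hcont : Continuous fun x => (inner ℝ (z (x, t)).1 (g x) : ℝ) := hv.inner hg
  refine hcont.integrable_of_hasCompactSupport (hc.mono fun x hx h => hx ?_)
  have h' : (z (x, t)).1 = 0 := h
  simp only [h', inner_zero_left]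

lemma half_norm_sq_sub_le {V : Type*} [NormedAddCommGroup V] {a b : V} {c : ℝ}
    (h : ‖a - b‖ ≤ c) : 1 / 2 * ‖b‖ ^ 2 - c ^ 2 ≤ ‖a‖ ^ 2 := by
  have h1 : ‖b‖ ≤ ‖a‖ + c := by
    have := norm_sub_norm_le b a
    rw [norm_sub_rev] at this
    linarith
  have h2 := norm_nonneg b
  have h3 := norm_nonneg a
  have h4 := (norm_nonneg _).trans h
  nlinarith [sq_nonneg (‖a‖ - c)]

/-- Since cos² + sin² = 1, the shifts 0 and π/2 share ∫h² between them, so one of them receives at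
least half. No oscillation limit in k is needed. -/
lemma exists_phase_shift (ξ : Vec n) {h : Vec n → ℝ} (hh : Continuous h)
    (hc : HasCompactSupport h) (k : ℝ) :
    ∃ s, 1 / 2 * ∫ x, h x ^ 2 ≤ ∫ x, (h x * Real.cos (k * inner ℝ ξ x + s)) ^ 2 := by
  have hint : ∀ s, Integrable fun x => (h x * Real.cos (k * inner ℝ ξ x + s)) ^ 2 := fun s =>
    Continuous.integrable_of_hasCompactSupport (by fun_prop)
      (hc.mono fun x hx h0 => hx (by simp [show h x = 0 from h0]))
  have hsum : ∫ x, h x ^ 2 = (∫ x, (h x * Real.cos (k * inner ℝ ξ x + 0)) ^ 2) +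
      ∫ x, (h x * Real.cos (k * inner ℝ ξ x + Real.pi / 2)) ^ 2 := by
    rw [← integral_add (hint _) (hint _)]
    refine integral_congr_ae (Filter.Eventually.of_forall fun x => ?_)
    simp only [add_zero, Real.cos_add_pi_div_two]
    linear_combination (-(h x) ^ 2) * Real.sin_sq_add_cos_sq (k * inner ℝ ξ x)
  by_contra! hlt
  linarith [hlt 0, hlt (Real.pi / 2)]

/-- A neighbourhood of the compact segment through z(x₀,0) is still admissible, and z stays near
z(x₀,0) for small radii, so a wave of amplitude at most d and high frequency may be added. The
threshold r₀ does not depend on η: the balls are fixed first, and η is then chosen according to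
their number. -/
lemma exists_localized_flow (hn : 2 ≤ n) {z : Vec n × ℝ → State n} (hz : IsFlow z)
    (ha : ∀ p, Admissible (z p)) (x₀ : Vec n) {ε : ℝ} (hε : 0 < ε) :
    ∃ r₀ > 0, ∀ r ∈ Ioo 0 r₀, ∀ η > 0, ∃ w : Vec n × ℝ → State n, IsFlow w ∧
      (∀ p, p ∉ Metric.closedBall x₀ r ×ˢ Icc (-ε) ε → w p = 0) ∧
      (∀ p, Admissible (z p + w p)) ∧ WeaklySmall w η ∧
      energyGain n * (2 - ‖(z (x₀, 0)).1‖ ^ 2) ^ 2 * volume.real (Metric.closedBall x₀ r) ≤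
        ∫ x, ‖(w (x, 0)).1‖ ^ 2 := by
  have hn0 : n ≠ 0 := by omega
  have hn' : (0 : ℝ) < n := by exact_mod_cast Nat.pos_of_ne_zero hn0
  set s₀ := z (x₀, 0) with hs₀
  have hv := (ha (x₀, 0)).norm_sq_lt hn0 (hz.symmTraceZero _)
  obtain ⟨e, ξ, m, d, he, hξ, heξ, hd, hseg⟩ :=
    exists_admissible_segment hn (hz.symmTraceZero (x₀, 0)) (ha (x₀, 0))
  rw [← hs₀] at hd hseg hv
  have hd0 : 0 < d := lt_of_lt_of_le (div_pos (by linarith) (by positivity)) hd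
  have hcomp : IsCompact ((fun c : ℝ => s₀ + c • waveState e ξ m) '' Icc (-d) d) :=
    isCompact_Icc.image (by fun_prop)
  obtain ⟨ρ, hρ, hρsub⟩ := hcomp.exists_thickening_subset_open isOpen_admissible (by
    rintro _ ⟨c, hc, rfl⟩
    exact hseg c (abs_le.mpr hc))
  obtain ⟨r₁, hr₁, hball⟩ := Metric.continuousAt_iff.mp
    (hz.contDiff.continuous.continuousAt (x := (x₀, (0 : ℝ)))) (ρ / 2) (by positivity)
  refine ⟨r₁, hr₁, fun r hr η hη => ?_⟩
  have hr0 : 0 < r := hr.1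
  -- The bound r₁/2 keeps the time support inside the ball where z is close to z(x₀,0).
  set ε₁ := min ε (r₁ / 2) with hε₁
  have hε₁0 : 0 < ε₁ := by positivity
  let b₁ : ContDiffBump x₀ := ⟨r / 2, r, by positivity, by linarith⟩
  let b₂ : ContDiffBump (0 : ℝ) := ⟨ε₁ / 2, ε₁, by positivity, by linarith⟩
  let χ : Vec n × ℝ → ℝ := fun p => d * (b₁ p.1 * b₂ p.2)
  have hχ : ContDiff ℝ ∞ χ := contDiff_const.mul
    ((b₁.contDiff.comp contDiff_fst).mul (b₂.contDiff.comp contDiff_snd))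
  have hχsupp : tsupport χ ⊆ Metric.closedBall x₀ r ×ˢ Metric.closedBall (0 : ℝ) ε₁ := by
    refine closure_minimal (fun p hp => ?_)
      (Metric.isClosed_closedBall.prod Metric.isClosed_closedBall)
    have h1 : b₁ p.1 ≠ 0 := fun h => hp (by simp [χ, h])
    have h2 : b₂ p.2 ≠ 0 := fun h => hp (by simp [χ, h])
    have h1' : p.1 ∈ Function.support b₁ := h1
    have h2' : p.2 ∈ Function.support b₂ := h2
    rw [b₁.support_eq] at h1'
    rw [b₂.support_eq] at h2'
    exact ⟨Metric.ball_subset_closedBall h1', Metric.ball_subset_closedBall h2'⟩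
  have hχc : HasCompactSupport χ :=
    ((isCompact_closedBall x₀ r).prod (isCompact_closedBall (0 : ℝ) ε₁)).of_isClosed_subset
      (isClosed_tsupport _) hχsupp
  have hχd : ∀ p, |χ p| ≤ d := fun p => by
    rw [abs_of_nonneg (mul_nonneg hd0.le (mul_nonneg b₁.nonneg b₂.nonneg))]
    calc d * (b₁ p.1 * b₂ p.2) ≤ d * 1 := by
          gcongr; exact mul_le_one₀ b₁.le_one b₂.nonneg b₂.le_one
      _ = d := mul_one d
  obtain ⟨C, hC⟩ := exists_norm_planarFlow_sub_le he hξ heξ m hχ hχc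
  -- The three bounds secure admissibility, weak smallness and the energy gain. The main energy term
  -- is at least (1/4) d² 2⁻ⁿ |B|, because the cutoff equals 1 on the half ball. The last bound
  -- makes the loss κ²|B| at most 1/16 of d² 2⁻ⁿ |B|, and 1/8 of it is all that is claimed.
  set κ := min (min (ρ / 2) (η / 2)) (d / (4 * 2 ^ n)) with hκ
  have hκ0 : 0 < κ := by positivity
  obtain ⟨k, hk1, hkC⟩ : ∃ k : ℝ, 1 ≤ k ∧ C / k < κ := by
    obtain ⟨k, hk⟩ := exists_gt (max 1 (C / κ))
    have hk0 : 0 < k := by linarith [le_max_left 1 (C / κ)]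
    refine ⟨k, ((le_max_left _ _).trans_lt hk).le, ?_⟩
    rw [div_lt_iff₀ hk0, mul_comm, ← div_lt_iff₀ hκ0]
    exact (le_max_right _ _).trans_lt hk
  have hh : Continuous fun x => χ (x, 0) := hχ.continuous.comp (by fun_prop)
  obtain ⟨s, hs⟩ := exists_phase_shift ξ hh (hasCompactSupport_slice hχc 0) k
  have hφ := contDiff_wavePotential ξ m hχ k s
  have hφsupp := tsupport_wavePotential_subset ξ m χ k s
  have hφc : HasCompactSupport (wavePotential ξ m χ k s) :=
    hχc.mono' ((subset_tsupport _).trans hφsupp)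
  have hw := isFlow_planarFlow he hξ heξ hφ hφc
  have hwsupp : ∀ p, p ∉ Metric.closedBall x₀ r ×ˢ Metric.closedBall (0 : ℝ) ε₁ →
      planarFlow e ξ (wavePotential ξ m χ k s) p = 0 := fun p hp => by
    by_contra h
    exact hp (hχsupp (hφsupp (support_planarFlow_subset e ξ _ h)))
  set w := planarFlow e ξ (wavePotential ξ m χ k s) with hwdef
  have hwM : ∀ p, ‖w p - modulated χ (phase ξ m) k s p • waveState e ξ m‖ < κ := fun p =>
    (hC k hk1 s p).1.trans_lt hkC
  refine ⟨w, hw, fun p hp => hwsupp p fun h => hp ⟨h.1, ?_⟩, fun p => ?_, ?_, ?_⟩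
  · have := h.2
    rw [Metric.mem_closedBall, Real.dist_eq, sub_zero] at this
    exact abs_le.mp (this.trans (min_le_left _ _))
  · by_cases hp : p ∈ Metric.closedBall x₀ r ×ˢ Metric.closedBall (0 : ℝ) ε₁
    · apply hρsub
      rw [Metric.mem_thickening_iff]
      refine ⟨_, ⟨modulated χ (phase ξ m) k s p, ?_, rfl⟩, ?_⟩
      · rw [mem_Icc, ← abs_le, modulated, abs_mul]
        calc _ ≤ d * 1 := by gcongr; exacts [hχd p, Real.abs_cos_le_one _]
          _ = d := mul_one d
      · have h1 : dist (z p) s₀ < ρ / 2 := by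
          refine hball ?_
          rw [Prod.dist_eq]
          refine max_lt (hp.1.trans_lt hr.2) (hp.2.trans_lt ?_)
          exact (min_le_right _ _).trans_lt (by linarith)
        rw [dist_eq_norm] at h1 ⊢
        have h2 := hwM p
        have h3 : κ ≤ ρ / 2 := (min_le_left _ _).trans (min_le_left _ _)
        have : z p + w p - (s₀ + modulated χ (phase ξ m) k s p • waveState e ξ m) =
          (z p - s₀) + (w p - modulated χ (phase ξ m) k s p • waveState e ξ m) := by abel
        rw [this]
        linarith [norm_add_le (z p - s₀) (w p - modulated χ (phase ξ m) k s p • waveState e ξ m)]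
    · rw [hwsupp p hp, add_zero]; exact ha p
  · have h1 : κ ≤ η / 2 := (min_le_left _ _).trans (min_le_right _ _)
    have := weaklySmall_planarFlow he hξ hφ hφc (ε := η / 2)
      fun p => (hC k hk1 s p).2.trans (hkC.le.trans h1)
    rwa [mul_div_cancel₀ _ two_ne_zero] at this
  · set B := Metric.closedBall x₀ r with hB
    have hBfin : volume B ≠ ⊤ := (isCompact_closedBall x₀ r).measure_ne_top
    have hpt : ∀ x, 1 / 2 * (χ (x, 0) * Real.cos (k * inner ℝ ξ x + s)) ^ 2 -
        B.indicator (fun _ => κ ^ 2) x ≤ ‖(w (x, 0)).1‖ ^ 2 := by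
      intro x
      by_cases hx : x ∈ B
      · rw [indicator_of_mem hx]
        have h1 : ‖(w (x, 0)).1 - (χ (x, 0) * Real.cos (k * inner ℝ ξ x + s)) • e‖ ≤ κ := by
          have := (norm_fst_le _).trans (hwM (x, 0)).le
          simpa [modulated, phase_apply, waveState] using this
        have h2 := half_norm_sq_sub_le h1
        rwa [norm_smul, he, mul_one, Real.norm_eq_abs, sq_abs] at h2
      · have h0 : b₁ x = 0 := by
          by_contra h
          have h' : x ∈ Function.support b₁ := h
          rw [b₁.support_eq] at h'
          exact hx (Metric.ball_subset_closedBall h')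
        simp [indicator_of_notMem hx, χ, h0]
    have hint₁ : Integrable fun x => 1 / 2 * (χ (x, 0) * Real.cos (k * inner ℝ ξ x + s)) ^ 2 :=
      Continuous.integrable_of_hasCompactSupport (by fun_prop)
        ((hasCompactSupport_slice hχc 0).mono fun x hx h0 =>
          hx (by simp [show χ (x, 0) = 0 from h0]))
    have hint₂ : Integrable (B.indicator fun _ => κ ^ 2) :=
      (integrable_indicator_iff measurableSet_closedBall).mpr (integrableOn_const hBfin)
    have h1 := integral_mono (hint₁.sub hint₂) (hw.integrable_norm_sq 0) hpt
    rw [integral_sub' hint₁ hint₂, integral_indicator measurableSet_closedBall,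
      setIntegral_const, integral_const_mul, smul_eq_mul, ← hB] at h1
    have hvol : volume.real (Metric.closedBall x₀ (r / 2)) = (1 / 2) ^ n * volume.real B := by
      rw [hB, Measure.addHaar_real_closedBall' _ _ (by positivity),
        Measure.addHaar_real_closedBall' _ _ hr0.le, finrank_euclideanSpace_fin]
      ring
    have h2 : d ^ 2 * ((1 / 2) ^ n * volume.real B) ≤ ∫ x, χ (x, 0) ^ 2 := by
      have hint₃ : Integrable fun x => χ (x, 0) ^ 2 :=
        Continuous.integrable_of_hasCompactSupport (by fun_prop)
          ((hasCompactSupport_slice hχc 0).mono fun x hx h0 =>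
            hx (by simp [show χ (x, 0) = 0 from h0]))
      have hint₄ : Integrable ((Metric.closedBall x₀ (r / 2)).indicator fun _ => d ^ 2) :=
        (integrable_indicator_iff measurableSet_closedBall).mpr
          (integrableOn_const (isCompact_closedBall x₀ (r / 2)).measure_ne_top)
      have h3 := integral_mono hint₄ hint₃ fun x => by
        by_cases hx : x ∈ Metric.closedBall x₀ (r / 2)
        · have hx1 : b₁ x = 1 := b₁.one_of_mem_closedBall hx
          have hx2 : b₂ 0 = 1 := b₂.one_of_mem_closedBall (Metric.mem_closedBall_self b₂.rIn_pos.le)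
          simp [indicator_of_mem hx, χ, hx1, hx2]
        · simp only [indicator_of_notMem hx]; positivity
      rw [integral_indicator measurableSet_closedBall, setIntegral_const, smul_eq_mul, hvol] at h3
      linarith
    have hκd : κ ^ 2 ≤ 1 / 16 * (d ^ 2 * (1 / 2) ^ n) := by
      have h4 : κ ≤ d / (4 * 2 ^ n) := min_le_right _ _
      have h5 : (1 : ℝ) ≤ 2 ^ n := one_le_pow₀ (by norm_num)
      calc κ ^ 2 ≤ (d / (4 * 2 ^ n)) ^ 2 := by gcongr
        _ = 1 / 16 * (d ^ 2 * (1 / 2) ^ n) * (1 / 2 ^ n) := by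
          rw [one_div_pow]; field_simp; norm_num
        _ ≤ 1 / 16 * (d ^ 2 * (1 / 2) ^ n) * 1 := by
          gcongr; rw [div_le_one (by positivity)]; exact h5
        _ = _ := mul_one _
    have hgain : energyGain n * (2 - ‖s₀.1‖ ^ 2) ^ 2 ≤ 1 / 8 * (d ^ 2 * (1 / 2) ^ n) := by
      calc energyGain n * (2 - ‖s₀.1‖ ^ 2) ^ 2 =
            1 / 8 * (((2 - ‖s₀.1‖ ^ 2) / (8 * n)) ^ 2 * (1 / 2) ^ n) := by
            unfold energyGain; rw [one_div_pow]; field_simp; ring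
        _ ≤ _ := by
          have : 0 ≤ (2 - ‖s₀.1‖ ^ 2) / (8 * n) := div_nonneg (by linarith) (by positivity)
          gcongr
    have hB0 : 0 ≤ volume.real B := measureReal_nonneg
    have h6 := mul_le_mul_of_nonneg_right hκd hB0
    have h7 := mul_le_mul_of_nonneg_right hgain hB0
    have h8 : 0 ≤ d ^ 2 * (1 / 2) ^ n * volume.real B := by positivity
    linarith

end

/-! ### Subsolutions and the perturbation step -/

section

variable {n : ℕ}

/-- Smooth subsolutions whose compact support lies in `Ω × ℝ`. -/
structure IsSubsolution (Ω : Set (Vec n)) (z : Vec n × ℝ → State n) : Prop where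
  isFlow : IsFlow z
  admissible : ∀ p, Admissible (z p)
  tsupport_subset : tsupport z ⊆ Ω ×ˢ univ

lemma WeaklySmall.mono {w : Vec n × ℝ → State n} {η η' : ℝ} (hw : WeaklySmall w η)
    (h : η ≤ η') : WeaklySmall w η' := fun g hg hgc t =>
  (hw g hg hgc t).trans (mul_le_mul_of_nonneg_right h (integral_nonneg fun _ => norm_nonneg _))

lemma weaklySmall_zero {η : ℝ} (hη : 0 ≤ η) : WeaklySmall (0 : Vec n × ℝ → State n) η := by
  intro g _ _ t
  have : 0 ≤ ∫ x, ‖fderiv ℝ g x‖ := integral_nonneg fun _ => norm_nonneg _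
  simp only [Pi.zero_apply, Prod.fst_zero, inner_zero_left, integral_zero, abs_zero]
  positivity

lemma WeaklySmall.add {w w' : Vec n × ℝ → State n} {η η' : ℝ} (hw : WeaklySmall w η)
    (hw' : WeaklySmall w' η') (hf : IsFlow w) (hf' : IsFlow w') :
    WeaklySmall (w + w') (η + η') := by
  intro g hg hgc t
  simp only [Pi.add_apply, Prod.fst_add, inner_add_left]
  rw [integral_add (hf.integrable_inner t hg.continuous) (hf'.integrable_inner t hg.continuous),
    add_mul]
  exact (abs_add_le _ _).trans (add_le_add (hw g hg hgc t) (hw' g hg hgc t))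

lemma isFlow_sum {ι : Type*} (F : Finset ι) {w : ι → Vec n × ℝ → State n}
    (hw : ∀ i ∈ F, IsFlow (w i)) : IsFlow (∑ i ∈ F, w i) :=
  Finset.sum_induction _ IsFlow (fun _ _ => IsFlow.add) (isFlow_zero n) hw

lemma weaklySmall_sum {ι : Type*} (F : Finset ι) {w : ι → Vec n × ℝ → State n} {η : ℝ}
    (hw : ∀ i ∈ F, IsFlow (w i)) (hη : ∀ i ∈ F, WeaklySmall (w i) η) :
    WeaklySmall (∑ i ∈ F, w i) (F.card * η) := by
  classical
  induction F using Finset.induction_on with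
  | empty => simpa using weaklySmall_zero le_rfl
  | insert i F hi ih =>
    rw [Finset.sum_insert hi, Finset.card_insert_of_notMem hi]
    have := (hη i (by simp)).add (ih (fun j hj => hw j (by simp [hj])) fun j hj =>
      hη j (by simp [hj])) (hw i (by simp)) (isFlow_sum F fun j hj => hw j (by simp [hj]))
    push_cast
    rwa [add_mul, one_mul, add_comm (_ * η)]

/-- The squared distance of `|v|²` at time zero to its extremal value. -/
def energyDefect (z : Vec n × ℝ → State n) (x : Vec n) : ℝ := (2 - ‖(z (x, 0)).1‖ ^ 2) ^ 2

lemma IsFlow.continuous_energyDefect {z : Vec n × ℝ → State n} (hz : IsFlow z) :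
    Continuous (energyDefect z) := by
  have := (hz.contDiff_slice 0).continuous
  unfold energyDefect
  fun_prop

lemma IsSubsolution.norm_sq_lt (hn : 2 ≤ n) {Ω : Set (Vec n)} {z : Vec n × ℝ → State n}
    (hz : IsSubsolution Ω z) (p : Vec n × ℝ) : ‖(z p).1‖ ^ 2 < 2 :=
  (hz.admissible p).norm_sq_lt (by omega) (hz.isFlow.symmTraceZero p)

lemma IsFlow.integrableOn_energyDefect {z : Vec n × ℝ → State n} (hz : IsFlow z)
    {Ω : Set (Vec n)} (hΩb : Bornology.IsBounded Ω) : IntegrableOn (energyDefect z) Ω :=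
  (hz.continuous_energyDefect.continuousOn.integrableOn_compact hΩb.isCompact_closure).mono_set
    subset_closure

/-- The Besicovitch theorem covers almost all of Ω by countably many disjoint balls so small that h
≤ 2h(x) on the ball around x. One factor 1/2 comes from keeping finitely many balls, the other from
replacing h by its value at the centre. -/
lemma exists_finset_disjoint_closedBall {Ω : Set (Vec n)} (hΩ : IsOpen Ω) {h : Vec n → ℝ}
    (hh : Continuous h) (hpos : ∀ x, 0 < h x) (hint : IntegrableOn h Ω)
    (hI : 0 < ∫ x in Ω, h x) {R : Vec n → ℝ} (hR : ∀ x, 0 < R x) :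
    ∃ (F : Finset (Vec n)) (r : Vec n → ℝ), (∀ x ∈ F, r x ∈ Ioo 0 (R x)) ∧
      (∀ x ∈ F, Metric.closedBall x (r x) ⊆ Ω) ∧
      (F : Set (Vec n)).PairwiseDisjoint (fun x => Metric.closedBall x (r x)) ∧
      1 / 4 * ∫ x in Ω, h x ≤ ∑ x ∈ F, h x * volume.real (Metric.closedBall x (r x)) := by
  classical
  have hR' : ∀ x ∈ Ω, ∃ ρ > 0, ρ ≤ R x ∧ ∀ r < ρ, Metric.closedBall x r ⊆ Ω ∧
      ∀ y ∈ Metric.closedBall x r, h y ≤ 2 * h x := by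
    intro x hx
    obtain ⟨ρ₁, hρ₁, h₁⟩ := Metric.isOpen_iff.mp hΩ x hx
    have hev : ∀ᶠ y in nhds x, h y < 2 * h x :=
      hh.continuousAt.eventually (gt_mem_nhds (by linarith [hpos x]))
    obtain ⟨ρ₂, hρ₂, h₂⟩ := Metric.eventually_nhds_iff_ball.mp hev
    refine ⟨min (R x) (min ρ₁ ρ₂), lt_min (hR x) (lt_min hρ₁ hρ₂), min_le_left _ _,
      fun r hr => ⟨fun y hy => h₁ ?_, fun y hy => (h₂ y ?_).le⟩⟩
    · exact hy.trans_lt (hr.trans_le ((min_le_right _ _).trans (min_le_left _ _)))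
    · exact hy.trans_lt (hr.trans_le ((min_le_right _ _).trans (min_le_right _ _)))
  choose! ρ hρ hρR hρsub using hR'
  obtain ⟨t, r, htc, htΩ, htr, htμ, htd⟩ := Besicovitch.exists_disjoint_closedBall_covering_ae
    (volume : Measure (Vec n)) (fun _ => univ) Ω
    (fun x _ δ hδ => ⟨δ / 2, trivial, by positivity, by linarith⟩) ρ hρ
  have : Countable t := htc.to_subtype
  have hsubΩ : ∀ x : t, Metric.closedBall (x : Vec n) (r x) ⊆ Ω := fun x =>
    (hρsub x (htΩ x.2) _ (htr x x.2).2.2).1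
  have hU : (⋃ x : t, Metric.closedBall (x : Vec n) (r x)) ⊆ Ω := iUnion_subset hsubΩ
  have hsum := hasSum_integral_iUnion (μ := volume) (f := h)
    (s := fun x : t => Metric.closedBall (x : Vec n) (r x))
    (fun x => measurableSet_closedBall)
    (fun x y hxy => htd x.2 y.2 (fun h => hxy (Subtype.ext h))) (hint.mono_set hU)
  have hUeq : ∫ x in ⋃ x : t, Metric.closedBall (x : Vec n) (r x), h x = ∫ x in Ω, h x := by
    refine setIntegral_congr_set ?_
    refine hU.eventuallyLE.antisymm ?_
    rw [ae_le_set]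
    rwa [biUnion_eq_iUnion] at htμ
  rw [hUeq] at hsum
  obtain ⟨F, hF⟩ := (hsum.eventually (lt_mem_nhds (half_lt_self hI))).exists
  refine ⟨F.map (Function.Embedding.subtype _), r, ?_, ?_, ?_, ?_⟩
  · intro x hx
    obtain ⟨y, -, rfl⟩ := Finset.mem_map.mp hx
    exact ⟨(htr y y.2).2.1, (htr y y.2).2.2.trans_le (hρR y (htΩ y.2))⟩
  · intro x hx
    obtain ⟨y, -, rfl⟩ := Finset.mem_map.mp hx
    exact hsubΩ y
  · refine htd.subset fun x hx => ?_
    obtain ⟨y, -, rfl⟩ := Finset.mem_map.mp hx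
    exact y.2
  · rw [Finset.sum_map]
    have : ∀ x ∈ F, ∫ y in Metric.closedBall (x : Vec n) (r x), h y ≤
        2 * (h x * volume.real (Metric.closedBall (x : Vec n) (r x))) := by
      intro x _
      have hfin : volume (Metric.closedBall (x : Vec n) (r x)) ≠ ⊤ :=
        (isCompact_closedBall _ _).measure_ne_top
      calc _ ≤ ∫ y in Metric.closedBall (x : Vec n) (r x), 2 * h x :=
            setIntegral_mono_on (hint.mono_set (hsubΩ x)) (integrableOn_const hfin)
              measurableSet_closedBall (hρsub x (htΩ x.2) _ (htr x x.2).2.2).2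
        _ = _ := by rw [setIntegral_const, smul_eq_mul]; ring
    have h2 := Finset.sum_le_sum this
    rw [← Finset.mul_sum] at h2
    simp only [Function.Embedding.subtype_apply]
    linarith

/-- Disjoint supports make admissibility a question about a single wave and make the energies add,
for a gain of γI/4, where γ is `energyGain n` and I is the integrated defect. The cross term 2∫⟨w,z⟩
is small because w is weakly small and z(·,0) is an admissible test field; it costs at most γI/8. -/
lemma exists_perturbation (hn : 2 ≤ n) {Ω : Set (Vec n)} (hΩ : IsOpen Ω)
    (hΩb : Bornology.IsBounded Ω) {z : Vec n × ℝ → State n} (hz : IsSubsolution Ω z) {ε η : ℝ}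
    (hε : 0 < ε) (hη : 0 < η) :
    ∃ w : Vec n × ℝ → State n, IsFlow w ∧ IsSubsolution Ω (z + w) ∧
      (∀ p, ε < |p.2| → w p = 0) ∧ WeaklySmall w η ∧
      (∫ x, ‖(z (x, 0)).1‖ ^ 2) + energyGain n / 8 * ∫ x in Ω, energyDefect z x ≤
        ∫ x, ‖((z + w) (x, 0)).1‖ ^ 2 := by
  classical
  rcases le_or_gt (∫ x in Ω, energyDefect z x) 0 with hI | hI
  · refine ⟨0, isFlow_zero n, by rwa [add_zero], fun _ _ => rfl, weaklySmall_zero hη.le, ?_⟩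
    have := mul_nonpos_of_nonneg_of_nonpos
      (div_nonneg (energyGain_pos (n := n) (by omega)).le (by norm_num : (0 : ℝ) ≤ 8)) hI
    rw [add_zero]
    linarith
  have hγ := energyGain_pos (n := n) (by omega)
  choose R hR hRw using fun x => exists_localized_flow hn hz.isFlow hz.admissible x hε
  obtain ⟨F, r, hr, hsub, hdisj, hsum⟩ := exists_finset_disjoint_closedBall hΩ
    hz.isFlow.continuous_energyDefect (fun x => by
      have := hz.norm_sq_lt hn (x, 0)
      exact pow_pos (by linarith) 2)
    (hz.isFlow.integrableOn_energyDefect hΩb) hI hR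
  set G := ∫ x, ‖fderiv ℝ (fun x => (z (x, 0)).1) x‖ with hG
  have hG0 : 0 ≤ G := integral_nonneg fun _ => norm_nonneg _
  set I := ∫ x in Ω, energyDefect z x
  -- The smallness of the individual waves adds up over the balls, hence the division by the
  -- cardinality. The second entry of the minimum makes |∫⟨w,z⟩| at most γI/16.
  set η' := min η (energyGain n / 8 * I / (2 * (G + 1))) / (F.card + 1) with hη'
  have hη'0 : 0 < η' := by positivity
  have hη'F : F.card * η' ≤ min η (energyGain n / 8 * I / (2 * (G + 1))) := by
    rw [hη', mul_div_assoc', div_le_iff₀ (by positivity), mul_comm]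
    gcongr
    linarith
  have hex : ∀ x ∈ F, ∃ w : Vec n × ℝ → State n, IsFlow w ∧
      (∀ p, p ∉ Metric.closedBall x (r x) ×ˢ Icc (-ε) ε → w p = 0) ∧
      (∀ p, Admissible (z p + w p)) ∧ WeaklySmall w η' ∧
      energyGain n * (2 - ‖(z (x, 0)).1‖ ^ 2) ^ 2 * volume.real (Metric.closedBall x (r x)) ≤
        ∫ x, ‖(w (x, 0)).1‖ ^ 2 := fun x hx => hRw x (r x) (hr x hx) η' hη'0
  choose! w hw hwsupp hwadm hwsmall hwgain using hex
  have hflow := isFlow_sum F hw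
  have hsmall : WeaklySmall (∑ x ∈ F, w x) (min η (energyGain n / 8 * I / (2 * (G + 1)))) :=
    (weaklySmall_sum F hw hwsmall).mono hη'F
  have hsingle : ∀ x ∈ F, ∀ p : Vec n × ℝ, p.1 ∈ Metric.closedBall x (r x) →
      ∀ y ∈ F, y ≠ x → w y p = 0 := fun x hx p hp y hy hyx => by
    refine hwsupp y hy p fun h => ?_
    exact Set.disjoint_left.mp (hdisj hy hx hyx) h.1 hp
  have hnone : ∀ p : Vec n × ℝ, (∀ x ∈ F, p.1 ∉ Metric.closedBall x (r x)) →
      ∀ x ∈ F, w x p = 0 := fun p hp x hx => hwsupp x hx p fun h => hp x hx h.1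
  refine ⟨∑ x ∈ F, w x, hflow, ⟨hz.isFlow.add hflow, fun p => ?_, ?_⟩, fun p hp => ?_,
    hsmall.mono (min_le_left _ _), ?_⟩
  · rw [Pi.add_apply, Finset.sum_apply]
    by_cases hp : ∃ x ∈ F, p.1 ∈ Metric.closedBall x (r x)
    · obtain ⟨x, hx, hpx⟩ := hp
      rw [Finset.sum_eq_single x (hsingle x hx p hpx) (fun h => absurd hx h)]
      exact hwadm x hx p
    · push Not at hp
      rw [Finset.sum_eq_zero (hnone p hp), add_zero]
      exact hz.admissible p
  · refine (tsupport_add _ _).trans (union_subset hz.tsupport_subset ?_)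
    have hcl : IsClosed ((⋃ x ∈ F, Metric.closedBall x (r x)) ×ˢ (univ : Set ℝ)) :=
      (F.finite_toSet.isClosed_biUnion fun x _ => Metric.isClosed_closedBall).prod isClosed_univ
    refine (closure_minimal (fun p hp => ?_) hcl).trans
      (prod_mono (iUnion₂_subset hsub) subset_rfl)
    refine ⟨?_, trivial⟩
    by_contra hcon
    refine hp ?_
    rw [Finset.sum_apply]
    refine Finset.sum_eq_zero (hnone p fun x hx h => hcon ?_)
    exact mem_biUnion (by exact_mod_cast hx) h
  · rw [Finset.sum_apply]
    refine Finset.sum_eq_zero fun x hx => hwsupp x hx p fun h => ?_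
    exact absurd (abs_le.mpr h.2) (not_le.mpr hp)
  · have hnormsum : ∀ x, ‖((∑ y ∈ F, w y) (x, 0)).1‖ ^ 2 = ∑ y ∈ F, ‖(w y (x, 0)).1‖ ^ 2 := by
      intro x
      rw [Finset.sum_apply]
      by_cases hp : ∃ y ∈ F, x ∈ Metric.closedBall y (r y)
      · obtain ⟨y, hy, hpy⟩ := hp
        rw [Finset.sum_eq_single y (hsingle y hy (x, 0) hpy) (fun h => absurd hy h),
          Finset.sum_eq_single y (fun y' hy' hne => by
            rw [hsingle y hy (x, 0) hpy y' hy' hne]; simp) (fun h => absurd hy h)]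
      · push Not at hp
        rw [Finset.sum_eq_zero (hnone (x, 0) hp), Finset.sum_eq_zero fun y hy => by
          rw [hnone (x, 0) hp y hy]; simp]
        simp
    have hE : ∫ x, ‖((∑ y ∈ F, w y) (x, 0)).1‖ ^ 2 = ∑ y ∈ F, ∫ x, ‖(w y (x, 0)).1‖ ^ 2 := by
      simp only [hnormsum]
      exact integral_finsetSum F fun y hy => (hw y hy).integrable_norm_sq 0
    have hE2 : energyGain n * (1 / 4 * I) ≤ ∫ x, ‖((∑ y ∈ F, w y) (x, 0)).1‖ ^ 2 := by
      rw [hE]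
      refine (mul_le_mul_of_nonneg_left hsum hγ.le).trans ?_
      rw [Finset.mul_sum]
      refine Finset.sum_le_sum fun y hy => ?_
      rw [← mul_assoc]
      exact hwgain y hy
    have hcross := hsmall _ (hz.isFlow.contDiff_slice 0) (hz.isFlow.hasCompactSupport_slice 0) 0
    have hcross2 : min η (energyGain n / 8 * I / (2 * (G + 1))) * G ≤ energyGain n / 16 * I := by
      calc _ ≤ energyGain n / 8 * I / (2 * (G + 1)) * (G + 1) := by
            gcongr
            · exact min_le_right _ _
            · linarith
        _ = _ := by field_simp; norm_num
    rw [← hG] at hcross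
    have hexp : ∀ x, ‖((z + ∑ y ∈ F, w y) (x, 0)).1‖ ^ 2 = ‖(z (x, 0)).1‖ ^ 2 +
        (2 * inner ℝ ((∑ y ∈ F, w y) (x, 0)).1 (z (x, 0)).1 +
          ‖((∑ y ∈ F, w y) (x, 0)).1‖ ^ 2) := fun x => by
      rw [Pi.add_apply, Prod.fst_add, norm_add_sq_real, real_inner_comm]
      ring
    simp only [hexp]
    have hi := hflow.integrable_inner 0 (hz.isFlow.contDiff_slice 0).continuous
    have hi2 := hflow.integrable_norm_sq 0
    have hi3 : Integrable fun x => 2 * inner ℝ ((∑ y ∈ F, w y) (x, 0)).1 (z (x, 0)).1 +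
        ‖((∑ y ∈ F, w y) (x, 0)).1‖ ^ 2 := (hi.const_mul 2).add hi2
    rw [integral_add (hz.isFlow.integrable_norm_sq 0) hi3,
      integral_add (hi.const_mul 2) hi2, integral_const_mul]
    have := neg_le_of_abs_le (hcross.trans hcross2)
    linarith

end

/-! ### Hilbert space limits, the weak equations and the iteration -/

section

section Hilbert

variable {H : Type*} [NormedAddCommGroup H] [InnerProductSpace ℝ H]

/-- In ‖u_m - u_k‖² = ‖u_m‖² - ‖u_k‖² - 2⟨u_m - u_k, u_k⟩ the norms converge by monotonicity, and
the inner product telescopes into a geometric sum. -/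
lemma cauchySeq_of_norm_mono_of_inner_le {u : ℕ → H} {K : ℝ} (hK : ∀ k, ‖u k‖ ^ 2 ≤ K)
    (hmono : ∀ k, ‖u k‖ ^ 2 ≤ ‖u (k + 1)‖ ^ 2)
    (hcross : ∀ k, ∀ i ≤ k, |inner ℝ (u (k + 1) - u k) (u i)| ≤ (1 / 2) ^ k) :
    CauchySeq u := by
  have hm : Monotone fun k => ‖u k‖ ^ 2 := monotone_nat_of_le_succ hmono
  have hbdd : BddAbove (range fun k => ‖u k‖ ^ 2) := ⟨K, by rintro _ ⟨k, rfl⟩; exact hK k⟩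
  set L := ⨆ k, ‖u k‖ ^ 2
  have hL : Filter.Tendsto (fun k => ‖u k‖ ^ 2) Filter.atTop (nhds L) :=
    tendsto_atTop_ciSup hm hbdd
  have hinner : ∀ k m, k ≤ m →
      |inner ℝ (u m - u k) (u k)| ≤ 2 * (1 / 2) ^ k - 2 * (1 / 2) ^ m := by
    intro k m hkm
    induction m, hkm using Nat.le_induction with
    | base => simp
    | succ m hkm ih =>
      have h1 : u (m + 1) - u k = (u (m + 1) - u m) + (u m - u k) := by abel
      rw [h1, inner_add_left]
      refine (abs_add_le _ _).trans ?_
      have := hcross m k hkm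
      rw [pow_succ]
      linarith
  refine cauchySeq_of_le_tendsto_0' (fun k => Real.sqrt (L - ‖u k‖ ^ 2 + 4 * (1 / 2) ^ k))
    (fun k m hkm => ?_) ?_
  · rw [dist_comm, dist_eq_norm]
    refine Real.le_sqrt_of_sq_le ?_
    have h1 : ‖u m‖ ^ 2 = ‖u m - u k‖ ^ 2 + 2 * inner ℝ (u m - u k) (u k) + ‖u k‖ ^ 2 := by
      rw [← norm_add_sq_real, sub_add_cancel]
    have h2 := neg_le_of_abs_le (hinner k m hkm)
    have h3 : ‖u m‖ ^ 2 ≤ L := le_ciSup hbdd m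
    have h4 : (0 : ℝ) < (1 / 2) ^ m := by positivity
    linarith
  · have h1 : Filter.Tendsto (fun k : ℕ => (1 / 2 : ℝ) ^ k) Filter.atTop (nhds 0) :=
      tendsto_pow_atTop_nhds_zero_of_lt_one (by norm_num) (by norm_num)
    have h2 := (Real.continuous_sqrt.tendsto _).comp
      ((tendsto_const_nhds (x := L)).sub hL |>.add (h1.const_mul 4))
    simpa [Function.comp_def] using h2

/-- Against g in the dense set the increments are summable uniformly in t, so the limit is a uniform
limit of continuous functions. The uniform norm bound extends this to every h. -/
lemma continuous_inner_of_tendsto {U : ℕ → ℝ → H} {V : ℝ → H} {K : ℝ}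
    (hK : ∀ k t, ‖U k t‖ ≤ K)
    (hlim : ∀ t, Filter.Tendsto (fun k => U k t) Filter.atTop (nhds (V t))) {D : Set H}
    (hD : Dense D)
    (hsmall : ∀ g ∈ D, ∃ C, ∀ k t, |inner ℝ (U (k + 1) t - U k t) g| ≤ C * (1 / 2) ^ k)
    (hcont : ∀ g ∈ D, ∀ k, Continuous fun t => (inner ℝ (U k t) g : ℝ)) (h : H) :
    Continuous fun t => (inner ℝ (V t) h : ℝ) := by
  have hV : ∀ t, ‖V t‖ ≤ K := fun t =>
    le_of_tendsto (hlim t).norm (Filter.Eventually.of_forall fun k => hK k t)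
  have hK0 : 0 ≤ K := (norm_nonneg _).trans (hV 0)
  have hg : ∀ g ∈ D, Continuous fun t => (inner ℝ (V t) g : ℝ) := by
    intro g hg
    obtain ⟨C, hC⟩ := hsmall g hg
    refine TendstoUniformly.continuous (F := fun k t => inner ℝ (U k t) g) (p := Filter.atTop) ?_
      (Filter.Frequently.of_forall (hcont g hg))
    have hle : ∀ k t, dist (inner ℝ (U k t) g) (inner ℝ (V t) g) ≤ C * (1 / 2) ^ k / (1 - 1 / 2) := by
      intro k t
      refine dist_le_of_le_geometric_of_tendsto (1 / 2) C (by norm_num) (fun j => ?_)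
        ((hlim t).inner tendsto_const_nhds) k
      rw [dist_comm, Real.dist_eq, ← inner_sub_left]
      exact hC j t
    have h0 : Filter.Tendsto (fun k : ℕ => C * (1 / 2 : ℝ) ^ k / (1 - 1 / 2)) Filter.atTop
        (nhds 0) := by
      have := ((tendsto_pow_atTop_nhds_zero_of_lt_one (r := (1 / 2 : ℝ)) (by norm_num)
        (by norm_num)).const_mul C).div_const (1 - 1 / 2)
      simpa using this
    rw [Metric.tendstoUniformly_iff]
    intro ε hε
    filter_upwards [h0.eventually (gt_mem_nhds hε)] with k hk t
    rw [dist_comm]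
    exact (hle k t).trans_lt hk
  refine continuous_of_uniform_approx_of_continuous fun u hu => ?_
  obtain ⟨ε, hε, hu⟩ := Metric.mem_uniformity_dist.mp hu
  -- K + 1 rather than K, since K may vanish.
  obtain ⟨g, hgD, hgd⟩ := Metric.dense_iff.mp hD h (ε / (K + 1)) (by positivity)
  refine ⟨_, hg g hgd, fun t => hu ?_⟩
  have hdist : ‖h - g‖ < ε / (K + 1) := by
    rw [← dist_eq_norm, dist_comm]; exact hgD
  rw [Real.dist_eq, ← inner_sub_right]
  calc _ ≤ ‖V t‖ * ‖h - g‖ := abs_real_inner_le_norm _ _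
    _ ≤ K * ‖h - g‖ := by gcongr; exact hV t
    _ ≤ (K + 1) * ‖h - g‖ := by gcongr; linarith
    _ < (K + 1) * (ε / (K + 1)) := by gcongr
    _ = ε := by field_simp

end Hilbert

lemma inner_toLp {X F : Type*} [MeasurableSpace X] {μ : Measure X} [NormedAddCommGroup F]
    [InnerProductSpace ℝ F] {f g : X → F} (hf : MemLp f 2 μ) (hg : MemLp g 2 μ) :
    inner ℝ (hf.toLp f) (hg.toLp g) = ∫ x, inner ℝ (f x) (g x) ∂μ := by
  rw [L2.inner_def]
  refine integral_congr_ae ?_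
  filter_upwards [hf.coeFn_toLp, hg.coeFn_toLp] with x h1 h2
  rw [h1, h2]

lemma norm_toLp_sq {X F : Type*} [MeasurableSpace X] {μ : Measure X} [NormedAddCommGroup F]
    [InnerProductSpace ℝ F] {f : X → F} (hf : MemLp f 2 μ) :
    ‖hf.toLp f‖ ^ 2 = ∫ x, ‖f x‖ ^ 2 ∂μ := by
  rw [← real_inner_self_eq_norm_sq, inner_toLp]
  simp only [real_inner_self_eq_norm_sq]

variable {n : ℕ}

instance : (volume : Measure (Vec n × ℝ)).IsAddHaarMeasure :=
  inferInstanceAs ((volume : Measure (Vec n)).prod (volume : Measure ℝ)).IsAddHaarMeasure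

lemma integral_mul_dirDeriv {f φ : Vec n × ℝ → ℝ} (hf : ContDiff ℝ ∞ f) (hφ : ContDiff ℝ ∞ φ)
    (hφc : HasCompactSupport φ) (a : Vec n × ℝ) :
    ∫ p, f p * fderiv ℝ φ p a = -∫ p, dirDeriv a f p * φ p := by
  have hdf := (hf.dirDeriv a).continuous
  have hdφ := (hφ.dirDeriv a).continuous
  exact integral_mul_fderiv_eq_neg_fderiv_mul_of_integrable
    ((hdf.mul hφ.continuous).integrable_of_hasCompactSupport (HasCompactSupport.mul_left hφc))
    ((hf.continuous.mul hdφ).integrable_of_hasCompactSupport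
      (HasCompactSupport.mul_left (hφc.fderiv_apply ℝ a)))
    ((hf.continuous.mul hφ.continuous).integrable_of_hasCompactSupport
      (HasCompactSupport.mul_left hφc))
    (fun x _ => differentiable_of_smooth hf x) (fun x _ => differentiable_of_smooth hφ x)

lemma integrable_mul_fderiv {f φ : Vec n × ℝ → ℝ} (hf : Continuous f) (hφ : ContDiff ℝ ∞ φ)
    (hφc : HasCompactSupport φ) (a : Vec n × ℝ) : Integrable fun p => f p * fderiv ℝ φ p a :=
  (hf.mul (hφ.dirDeriv a).continuous).integrable_of_hasCompactSupport
      (HasCompactSupport.mul_left (hφc.fderiv_apply ℝ a))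

lemma integrable_dirDeriv_mul {f φ : Vec n × ℝ → ℝ} (hf : ContDiff ℝ ∞ f)
    (hφ : ContDiff ℝ ∞ φ) (hφc : HasCompactSupport φ) (a : Vec n × ℝ) :
    Integrable fun p => dirDeriv a f p * φ p :=
  ((hf.dirDeriv a).continuous.mul hφ.continuous).integrable_of_hasCompactSupport
    (HasCompactSupport.mul_left hφc)

lemma IsFlow.integral_momentum {z : Vec n × ℝ → State n} (hz : IsFlow z)
    {φ : Vec n × ℝ → ℝ} (hφ : ContDiff ℝ ∞ φ) (hφc : HasCompactSupport φ) (i : Fin n) :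
    ∫ p, ((z p).1 i * fderiv ℝ φ p (timeDir n) +
      ∑ j, (z p).2 i j * fderiv ℝ φ p (spaceDir j)) = 0 := by
  rw [integral_add (integrable_mul_fderiv (hz.contDiff_fst i).continuous hφ hφc _)
    (integrable_finsetSum _ fun j _ =>
      integrable_mul_fderiv (hz.contDiff_snd i j).continuous hφ hφc _),
    integral_finsetSum _ fun j _ =>
      integrable_mul_fderiv (hz.contDiff_snd i j).continuous hφ hφc _]
  simp only [integral_mul_dirDeriv (hz.contDiff_fst i) hφ hφc,
    integral_mul_dirDeriv (hz.contDiff_snd i _) hφ hφc]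
  rw [Finset.sum_neg_distrib, ← integral_finsetSum _ fun j _ =>
    integrable_dirDeriv_mul (hz.contDiff_snd i j) hφ hφc _, ← neg_add,
    ← integral_add (integrable_dirDeriv_mul (hz.contDiff_fst i) hφ hφc _)
    (integrable_finsetSum _ fun j _ => integrable_dirDeriv_mul (hz.contDiff_snd i j) hφ hφc _)]
  simp only [← Finset.sum_mul, ← add_mul, hz.momentum, zero_mul, integral_zero, neg_zero]

lemma IsFlow.integral_divergence {z : Vec n × ℝ → State n} (hz : IsFlow z)
    {φ : Vec n × ℝ → ℝ} (hφ : ContDiff ℝ ∞ φ) (hφc : HasCompactSupport φ) :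
    ∫ p, ∑ i, (z p).1 i * fderiv ℝ φ p (spaceDir i) = 0 := by
  rw [integral_finsetSum _ fun i _ =>
      integrable_mul_fderiv (hz.contDiff_fst i).continuous hφ hφc _]
  simp only [integral_mul_dirDeriv (hz.contDiff_fst _) hφ hφc]
  rw [Finset.sum_neg_distrib, ← integral_finsetSum _ fun j _ =>
    integrable_dirDeriv_mul (hz.contDiff_fst j) hφ hφc _]
  simp only [← Finset.sum_mul, hz.divergence, zero_mul, integral_zero, neg_zero]

/-- A sequence of subsolutions, each obtained from the previous one by a weakly small perturbation
near time zero that increases the energy at time zero. -/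
structure IsIteration (Ω : Set (Vec n)) (T : ℝ) (z : ℕ → Vec n × ℝ → State n) : Prop where
  zero : z 0 = 0
  isSubsolution : ∀ k, IsSubsolution Ω (z k)
  isFlow_sub : ∀ k, IsFlow (z (k + 1) - z k)
  succ_eq : ∀ (k : ℕ) p, T / (k + 2) < |p.2| → z (k + 1) p = z k p
  weaklySmall : ∀ k, WeaklySmall (z (k + 1) - z k) ((1 / 2) ^ k)
  cross : ∀ k, ∀ i ≤ k,
    |∫ x, inner ℝ ((z (k + 1) - z k) (x, 0)).1 (z i (x, 0)).1| ≤ (1 / 2) ^ k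
  gain : ∀ k, (∫ x, ‖(z k (x, 0)).1‖ ^ 2) + energyGain n / 8 * ∫ x in Ω, energyDefect (z k) x ≤
    ∫ x, ‖(z (k + 1) (x, 0)).1‖ ^ 2

lemma isSubsolution_zero (hn : n ≠ 0) (Ω : Set (Vec n)) :
    IsSubsolution Ω (0 : Vec n × ℝ → State n) where
  isFlow := isFlow_zero n
  admissible p x hx := by
    have : (0 : ℝ) < n := by exact_mod_cast Nat.pos_of_ne_zero hn
    have : 0 < ‖x‖ := norm_pos_iff.mpr hx
    rw [defect_apply]
    simp
    positivity
  tsupport_subset := by simp [tsupport]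

/-- Near orthogonality is needed against all earlier states, not only the last. The recursion
therefore carries, besides the state, the number 1 + Σ G(z_i) over the earlier states. Dividing the
smallness by this number plus G of the current state handles all of them, the current one included.
-/
lemma exists_isIteration (hn : 2 ≤ n) {Ω : Set (Vec n)} (hΩ : IsOpen Ω)
    (hΩb : Bornology.IsBounded Ω) {T : ℝ} (hT : 0 < T) :
    ∃ z : ℕ → Vec n × ℝ → State n, IsIteration Ω T z := by
  let G : (Vec n × ℝ → State n) → ℝ := fun z => ∫ x, ‖fderiv ℝ (fun x => (z (x, 0)).1) x‖
  have hG : ∀ z, 0 ≤ G z := fun z => integral_nonneg fun _ => norm_nonneg _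
  have hstep : ∀ (k : ℕ) (q : {q : (Vec n × ℝ → State n) × ℝ // IsSubsolution Ω q.1 ∧ 1 ≤ q.2}),
      ∃ w : Vec n × ℝ → State n, IsFlow w ∧ IsSubsolution Ω (q.1.1 + w) ∧
        (∀ p, T / (k + 2) < |p.2| → w p = 0) ∧
        WeaklySmall w ((1 / 2) ^ k / (q.1.2 + G q.1.1)) ∧
        (∫ x, ‖(q.1.1 (x, 0)).1‖ ^ 2) + energyGain n / 8 * ∫ x in Ω, energyDefect q.1.1 x ≤
          ∫ x, ‖((q.1.1 + w) (x, 0)).1‖ ^ 2 := by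
    intro k q
    have h1 := q.2.2
    have h2 := hG q.1.1
    exact exists_perturbation hn hΩ hΩb q.2.1 (by positivity) (by positivity)
  choose w hw hsub hsupp hsmall hgain using hstep
  let q : ℕ → {q : (Vec n × ℝ → State n) × ℝ // IsSubsolution Ω q.1 ∧ 1 ≤ q.2} := fun k =>
    Nat.rec ⟨(0, 1), isSubsolution_zero (by omega) Ω, le_rfl⟩
      (fun k q => ⟨(q.1.1 + w k q, q.1.2 + G q.1.1), hsub k q, by
        linarith [q.2.2, hG q.1.1]⟩) k
  have hq1 : ∀ k, (q (k + 1)).1.1 = (q k).1.1 + w k (q k) := fun k => rfl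
  have hq2 : ∀ k, (q (k + 1)).1.2 = (q k).1.2 + G (q k).1.1 := fun k => rfl
  have hdiff : ∀ k, (q (k + 1)).1.1 - (q k).1.1 = w k (q k) := fun k => by
    rw [hq1, add_sub_cancel_left]
  have hmono : Monotone fun k => (q k).1.2 := monotone_nat_of_le_succ fun k => by
    rw [hq2]; linarith [hG (q k).1.1]
  have hGle : ∀ k, ∀ i ≤ k, G (q i).1.1 ≤ (q (k + 1)).1.2 := fun k i hi => by
    have h1 : (q (i + 1)).1.2 ≤ (q (k + 1)).1.2 := hmono (Nat.succ_le_succ hi)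
    rw [hq2 i] at h1
    linarith [(q i).2.2]
  refine ⟨fun k => (q k).1.1, rfl, fun k => (q k).2.1, fun k => ?_, fun k p hp => ?_,
    fun k => ?_, fun k i hi => ?_, fun k => hgain k (q k)⟩
  · rw [hdiff]; exact hw k (q k)
  · rw [hq1, Pi.add_apply, hsupp k (q k) p hp, add_zero]
  · rw [hdiff]
    refine (hsmall k (q k)).mono (div_le_self (by positivity) ?_)
    rw [← hq2]
    exact (q (k + 1)).2.2
  · have hf := (q i).2.1.isFlow
    rw [hdiff]
    refine (hsmall k (q k) _ (hf.contDiff_slice 0) (hf.hasCompactSupport_slice 0) 0).trans ?_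
    rw [← hq2]
    have h1 := (q (k + 1)).2.2
    rw [div_mul_eq_mul_div, div_le_iff₀ (by linarith)]
    exact mul_le_mul_of_nonneg_left (hGle k i hi) (by positivity)

end

/-! ### The limit of the iteration -/

section

variable {n : ℕ} {Ω : Set (Vec n)} {T : ℝ} {z : ℕ → Vec n × ℝ → State n}

lemma IsSubsolution.eq_zero_of_notMem {w : Vec n × ℝ → State n} (hw : IsSubsolution Ω w)
    {p : Vec n × ℝ} (hp : p.1 ∉ Ω) : w p = 0 :=
  image_eq_zero_of_notMem_tsupport fun h => hp (hw.tsupport_subset h).1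

lemma IsFlow.memLp_slice {w : Vec n × ℝ → State n} (hw : IsFlow w) (t : ℝ) :
    MemLp (fun x => (w (x, t)).1) 2 volume :=
  (hw.contDiff_slice t).continuous.memLp_of_hasCompactSupport (hw.hasCompactSupport_slice t)

/-- The time slice of the velocity, as an element of `L²`. -/
def IsFlow.slice {w : Vec n × ℝ → State n} (hw : IsFlow w) (t : ℝ) :
    Lp (Vec n) 2 (volume : Measure (Vec n)) :=
  (hw.memLp_slice t).toLp _

lemma IsSubsolution.norm_slice_sq_le (hn : 2 ≤ n) (hΩ : IsOpen Ω) (hΩb : Bornology.IsBounded Ω)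
    {w : Vec n × ℝ → State n} (hw : IsSubsolution Ω w) (t : ℝ) :
    ‖hw.isFlow.slice t‖ ^ 2 ≤ 2 * volume.real Ω := by
  unfold IsFlow.slice
  have hfin : volume Ω ≠ ⊤ := hΩb.measure_lt_top.ne
  have hint : Integrable (Ω.indicator fun _ => (2 : ℝ)) :=
    (integrable_indicator_iff hΩ.measurableSet).mpr (integrableOn_const hfin)
  rw [norm_toLp_sq]
  refine (integral_mono (hw.isFlow.integrable_norm_sq t) hint fun x => ?_).trans ?_
  · by_cases hx : x ∈ Ω
    · simpa [indicator_of_mem hx] using (hw.norm_sq_lt hn (x, t)).le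
    · have : w (x, t) = 0 := hw.eq_zero_of_notMem hx
      simp [indicator_of_notMem hx, this]
  · rw [integral_indicator hΩ.measurableSet, setIntegral_const, smul_eq_mul, mul_comm]

/-- Every step from index k on changes only times with |t| ≤ T/(k+2). -/
lemma IsIteration.eq_of_le (h : IsIteration Ω T z) {k m : ℕ} (hkm : k ≤ m) {p : Vec n × ℝ}
    (hp : T < (k + 2) * |p.2|) : z m p = z k p := by
  induction m, hkm using Nat.le_induction with
  | base => rfl
  | succ m hkm ih =>
    rw [h.succ_eq m p, ih]
    rw [div_lt_iff₀ (by positivity), mul_comm]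
    refine hp.trans_le ?_
    gcongr

/-- The window T/(k+2) is already T/2 at the first step, which leaves room for the closed support to
lie in the open interval ]-T,T[. -/
lemma IsIteration.eq_zero (h : IsIteration Ω T z) (k : ℕ) {p : Vec n × ℝ} (hp : T / 2 < |p.2|) :
    z k p = 0 := by
  rw [h.eq_of_le (Nat.zero_le k) (by push_cast; linarith), h.zero]
  rfl

/-- The limit of an iteration, with the velocity `V` prescribed at time zero in `Ω`. -/
def limitState (Ω : Set (Vec n)) (T : ℝ) (z : ℕ → Vec n × ℝ → State n) (V : Vec n → Vec n)
    (p : Vec n × ℝ) : State n :=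
  open Classical in if p.2 = 0 then (Ω.indicator V p.1, 0) else z ⌈T / |p.2|⌉₊ p

variable {V : Vec n → Vec n}

lemma limitState_zero (x : Vec n) : limitState Ω T z V (x, 0) = (Ω.indicator V x, 0) := by
  simp [limitState]

lemma limitState_of_ne {p : Vec n × ℝ} (hp : p.2 ≠ 0) :
    limitState Ω T z V p = z ⌈T / |p.2|⌉₊ p := by
  simp [limitState, hp]

lemma IsIteration.limitState_eq (h : IsIteration Ω T z) {p : Vec n × ℝ} (hp : p.2 ≠ 0) {k : ℕ}
    (hk : T ≤ k * |p.2|) : limitState Ω T z V p = z k p := by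
  have h0 : 0 < |p.2| := abs_pos.mpr hp
  rw [limitState_of_ne hp, ← h.eq_of_le (le_max_left _ k), ← h.eq_of_le (le_max_right _ k)]
  · linarith
  · have := Nat.le_ceil (T / |p.2|)
    rw [div_le_iff₀ h0] at this
    linarith

lemma IsIteration.eventually_eq_limitState (h : IsIteration Ω T z) {t : ℝ} (ht : t ≠ 0) :
    ∀ᶠ k in Filter.atTop, ∀ x, z k (x, t) = limitState Ω T z V (x, t) := by
  filter_upwards [Filter.eventually_ge_atTop ⌈T / |t|⌉₊] with k hk x
  refine (h.limitState_eq (p := (x, t)) ht ?_).symm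
  rw [← div_le_iff₀ (abs_pos.mpr ht)]
  exact (Nat.le_ceil _).trans (by exact_mod_cast hk)

/-- A single index k represents the limit on the whole neighbourhood where |t| exceeds half its
value at p. -/
lemma IsIteration.contDiffAt_limitState (h : IsIteration Ω T z) {p : Vec n × ℝ}
    (hp : p.2 ≠ 0) : ContDiffAt ℝ ∞ (limitState Ω T z V) p := by
  obtain ⟨k, hk⟩ := exists_nat_gt (T / (|p.2| / 2))
  have h0 : 0 < |p.2| := abs_pos.mpr hp
  rw [div_lt_iff₀ (by positivity)] at hk
  refine (h.isSubsolution k).isFlow.contDiff.contDiffAt.congr_of_eventuallyEq ?_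
  have hev : ∀ᶠ q : Vec n × ℝ in nhds p, |p.2| / 2 < |q.2| :=
    (continuous_snd.abs.tendsto p).eventually (lt_mem_nhds (by linarith))
  filter_upwards [hev] with q hq
  refine h.limitState_eq (abs_pos.mp (by linarith)) ?_
  refine hk.le.trans ?_
  gcongr

lemma IsIteration.symmTraceZero_limitState (h : IsIteration Ω T z) (p : Vec n × ℝ) :
    SymmTraceZero (limitState Ω T z V p) := by
  by_cases hp : p.2 = 0
  · have : p = (p.1, 0) := Prod.ext rfl hp
    rw [this, limitState_zero]
    exact ⟨fun _ _ => rfl, by simp⟩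
  · rw [limitState_of_ne hp]
    exact (h.isSubsolution _).isFlow.symmTraceZero p

lemma IsIteration.admissible_limitState (h : IsIteration Ω T z) {p : Vec n × ℝ} (hp : p.2 ≠ 0) :
    Admissible (limitState Ω T z V p) := by
  rw [limitState_of_ne hp]
  exact (h.isSubsolution _).admissible p

lemma IsIteration.tsupport_limitState_subset (h : IsIteration Ω T z) (hT : 0 < T) :
    tsupport (limitState Ω T z V) ⊆ closure Ω ×ˢ Ioo (-T) T := by
  refine (closure_minimal (t := closure Ω ×ˢ Icc (-(T / 2)) (T / 2)) (fun p hp => ⟨?_, ?_⟩)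
    (isClosed_closure.prod isClosed_Icc)).trans
    (prod_mono subset_rfl (Icc_subset_Ioo (by linarith) (by linarith)))
  · refine subset_closure ?_
    by_contra hΩ
    refine hp ?_
    by_cases hp0 : p.2 = 0
    · have : p = (p.1, 0) := Prod.ext rfl hp0
      rw [this, limitState_zero, indicator_of_notMem hΩ]
      rfl
    · rw [limitState_of_ne hp0]
      exact (h.isSubsolution _).eq_zero_of_notMem hΩ
  · rw [mem_Icc, ← abs_le]
    by_contra hlt
    push Not at hlt
    have hp0 : p.2 ≠ 0 := abs_pos.mp (by linarith)
    exact hp (by rw [limitState_of_ne hp0]; exact h.eq_zero _ hlt)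

lemma IsIteration.tsupport_slice_limitState (h : IsIteration Ω T z) {t : ℝ} (ht : t ≠ 0) :
    IsCompact (tsupport fun x => limitState Ω T z V (x, t)) ∧
      tsupport (fun x => limitState Ω T z V (x, t)) ⊆ Ω := by
  have heq : (fun x => limitState Ω T z V (x, t)) = fun x => z ⌈T / |t|⌉₊ (x, t) := by
    ext1 x; exact limitState_of_ne ht
  have hs := h.isSubsolution ⌈T / |t|⌉₊
  rw [heq]
  refine ⟨hasCompactSupport_slice hs.isFlow.hasCompactSupport t, ?_⟩
  have h1 : tsupport (fun x => z ⌈T / |t|⌉₊ (x, t)) ⊆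
      (fun x => (x, t)) ⁻¹' tsupport (z ⌈T / |t|⌉₊) :=
    closure_minimal (fun x hx => subset_tsupport _ hx)
      ((isClosed_tsupport _).preimage (by fun_prop))
  exact fun x hx => (hs.tsupport_subset (h1 hx)).1

lemma IsIteration.tendsto_slice_zero (hn : 2 ≤ n) (hΩ : IsOpen Ω) (hΩb : Bornology.IsBounded Ω)
    (h : IsIteration Ω T z) :
    ∃ V, Filter.Tendsto (fun k => (h.isSubsolution k).isFlow.slice 0) Filter.atTop (nhds V) := by
  refine cauchySeq_tendsto_of_complete (cauchySeq_of_norm_mono_of_inner_le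
    (fun k => (h.isSubsolution k).norm_slice_sq_le hn hΩ hΩb 0) (fun k => ?_) fun k i hi => ?_)
  · unfold IsFlow.slice
    rw [norm_toLp_sq, norm_toLp_sq]
    have h1 := h.gain k
    have h2 : 0 ≤ ∫ x in Ω, energyDefect (z k) x := integral_nonneg fun x => sq_nonneg _
    have h3 := energyGain_pos (n := n) (by omega)
    have : 0 ≤ energyGain n / 8 * ∫ x in Ω, energyDefect (z k) x := by positivity
    linarith
  · unfold IsFlow.slice
    rw [← MemLp.toLp_sub, inner_toLp]
    exact h.cross k i hi

/-- The gain inequality bounds the integrated defect by a fixed multiple of the energy increment,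
and the energies converge. -/
lemma IsIteration.tendsto_integral_energyDefect (hn : 2 ≤ n) (h : IsIteration Ω T z)
    {V : Lp (Vec n) 2 (volume : Measure (Vec n))}
    (hV : Filter.Tendsto (fun k => (h.isSubsolution k).isFlow.slice 0) Filter.atTop (nhds V)) :
    Filter.Tendsto (fun k => ∫ x in Ω, energyDefect (z k) x) Filter.atTop (nhds 0) := by
  have hE : Filter.Tendsto (fun k => ∫ x, ‖(z k (x, 0)).1‖ ^ 2) Filter.atTop (nhds (‖V‖ ^ 2)) := by
    refine (hV.norm.pow 2).congr fun k => ?_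
    exact norm_toLp_sq _
  have hdiff := ((hE.comp (Filter.tendsto_add_atTop_nat 1)).sub hE).const_mul
    (8 / energyGain n)
  rw [sub_self, mul_zero] at hdiff
  have h3 := energyGain_pos (n := n) (by omega)
  refine squeeze_zero (fun k => integral_nonneg fun x => sq_nonneg _) (fun k => ?_) hdiff
  have h1 := h.gain k
  rw [Function.comp_apply, div_mul_eq_mul_div, le_div_iff₀ h3]
  linarith

/-- Strong L² convergence gives an a.e. convergent subsequence. Dominated convergence on the bounded
set Ω, with bound 4, shows that ∫_Ω (2 - |V|²)² = 0. -/
lemma IsIteration.ae_limit (hn : 2 ≤ n) (hΩ : IsOpen Ω) (hΩb : Bornology.IsBounded Ω)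
    (h : IsIteration Ω T z) {V : Lp (Vec n) 2 (volume : Measure (Vec n))}
    (hV : Filter.Tendsto (fun k => (h.isSubsolution k).isFlow.slice 0) Filter.atTop (nhds V)) :
    (∀ᵐ x, x ∉ Ω → V x = 0) ∧ ∀ᵐ x, x ∈ Ω → ‖V x‖ ^ 2 = 2 := by
  obtain ⟨ns, hns, hae⟩ := (tendstoInMeasure_of_tendsto_Lp hV).exists_seq_tendsto_ae
  have hcoe : ∀ᵐ x, ∀ k, (h.isSubsolution k).isFlow.slice 0 x = (z k (x, 0)).1 :=
    ae_all_iff.mpr fun k => ((h.isSubsolution k).isFlow.memLp_slice 0).coeFn_toLp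
  have hlim : ∀ᵐ x, Filter.Tendsto (fun j => (z (ns j) (x, 0)).1) Filter.atTop (nhds (V x)) := by
    filter_upwards [hae, hcoe] with x h1 h2
    simpa only [h2] using h1
  constructor
  · filter_upwards [hlim] with x hx hxΩ
    refine tendsto_nhds_unique hx ?_
    have : ∀ j, z (ns j) (x, 0) = 0 := fun j => (h.isSubsolution _).eq_zero_of_notMem hxΩ
    simp [this]
  · have hfin : IsFiniteMeasure (volume.restrict Ω) := ⟨by
      rw [Measure.restrict_apply_univ]; exact hΩb.measure_lt_top⟩
    have hbound : ∀ k x, ‖energyDefect (z k) x‖ ≤ 4 := fun k x => by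
      have h1 := (h.isSubsolution k).norm_sq_lt hn (x, 0)
      have h2 := sq_nonneg ‖(z k (x, 0)).1‖
      rw [energyDefect, Real.norm_eq_abs, abs_of_nonneg (sq_nonneg _)]
      nlinarith
    have hlim2 : ∀ᵐ x, Filter.Tendsto (fun j => energyDefect (z (ns j)) x) Filter.atTop
        (nhds ((2 - ‖V x‖ ^ 2) ^ 2)) := by
      filter_upwards [hlim] with x hx
      exact ((tendsto_const_nhds.sub (hx.norm.pow 2)).pow 2)
    have hI := tendsto_integral_of_dominated_convergence (μ := volume.restrict Ω) (fun _ => 4)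
      (fun j => (h.isSubsolution (ns j)).isFlow.continuous_energyDefect.aestronglyMeasurable)
      (integrable_const _) (fun j => Filter.Eventually.of_forall (hbound (ns j)))
      (ae_restrict_of_ae hlim2)
    have h0 := tendsto_nhds_unique hI
      ((h.tendsto_integral_energyDefect hn hV).comp hns.tendsto_atTop)
    have hint : Integrable (fun x => (2 - ‖V x‖ ^ 2) ^ 2) (volume.restrict Ω) := by
      refine Integrable.of_bound (aestronglyMeasurable_of_tendsto_ae Filter.atTop
        (fun j => (h.isSubsolution (ns j)).isFlow.continuous_energyDefect.aestronglyMeasurable)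
        (ae_restrict_of_ae hlim2)) 4 ?_
      filter_upwards [ae_restrict_of_ae hlim2] with x hx
      exact le_of_tendsto hx.norm (Filter.Eventually.of_forall fun j => hbound (ns j) x)
    have h1 := (integral_eq_zero_iff_of_nonneg (fun x => sq_nonneg _) hint).mp h0
    rw [Filter.EventuallyEq, ae_restrict_iff' hΩ.measurableSet] at h1
    filter_upwards [h1] with x hx hxΩ
    have := pow_eq_zero_iff (two_ne_zero) |>.mp (hx hxΩ)
    linarith

end

/-! ### The limit solves the system and is weakly continuous -/

section

variable {n : ℕ} {Ω : Set (Vec n)} {T : ℝ} {z : ℕ → Vec n × ℝ → State n} {V : Vec n → Vec n}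

lemma ae_snd_ne_zero : ∀ᵐ p : Vec n × ℝ, p.2 ≠ 0 := by
  have h : ∀ᵐ t : ℝ, t ≠ 0 := compl_mem_ae_iff.mpr (measure_singleton 0)
  exact Measure.quasiMeasurePreserving_snd.ae h

lemma IsIteration.ae_tendsto_limitState (h : IsIteration Ω T z) :
    ∀ᵐ p : Vec n × ℝ, Filter.Tendsto (fun k => z k p) Filter.atTop
      (nhds (limitState Ω T z V p)) := by
  filter_upwards [ae_snd_ne_zero] with p hp
  refine tendsto_const_nhds.congr' ?_
  filter_upwards [h.eventually_eq_limitState (V := V) hp] with k hk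
  exact (hk p.1).symm

lemma IsSubsolution.norm_le (hn : 2 ≤ n) {w : Vec n × ℝ → State n} (hw : IsSubsolution Ω w)
    (p : Vec n × ℝ) : ‖w p‖ ≤ 6 := by
  rw [Prod.norm_def]
  refine max_le ?_ ?_
  · have := hw.norm_sq_lt hn p
    nlinarith [norm_nonneg (w p).1]
  · refine (pi_norm_le_iff_of_nonneg (by norm_num)).mpr fun i =>
      (pi_norm_le_iff_of_nonneg (by norm_num)).mpr fun j => ?_
    exact (hw.admissible p).abs_apply_le (by omega) (hw.isFlow.symmTraceZero p) i j

lemma IsSubsolution.norm_fst_apply_le (hn : 2 ≤ n) {w : Vec n × ℝ → State n}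
    (hw : IsSubsolution Ω w) (p : Vec n × ℝ) (i : Fin n) : ‖(w p).1 i‖ ≤ 6 :=
  (PiLp.norm_apply_le _ i).trans ((norm_fst_le _).trans (hw.norm_le hn p))

lemma IsSubsolution.norm_snd_apply_le (hn : 2 ≤ n) {w : Vec n × ℝ → State n}
    (hw : IsSubsolution Ω w) (p : Vec n × ℝ) (i j : Fin n) : ‖(w p).2 i j‖ ≤ 6 :=
  (hw.admissible p).abs_apply_le (by omega) (hw.isFlow.symmTraceZero p) i j

lemma IsIteration.locallyIntegrable_limitState (hn : 2 ≤ n) (h : IsIteration Ω T z) :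
    LocallyIntegrable (limitState Ω T z V) := by
  refine MemLp.locallyIntegrable (p := ⊤) (memLp_top_of_bound
    (aestronglyMeasurable_of_tendsto_ae Filter.atTop
      (fun k => (h.isSubsolution k).isFlow.contDiff.continuous.aestronglyMeasurable)
      h.ae_tendsto_limitState) 6 ?_) le_top
  filter_upwards [ae_snd_ne_zero] with p hp
  rw [limitState_of_ne hp]
  exact (h.isSubsolution _).norm_le hn p

/-- The entries of a symmetric traceless state, as a matrix. -/
def toSymTraceless (s : State n) (hs : SymmTraceZero s) : SymTraceless n :=
  ⟨Matrix.of s.2, by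
    refine ⟨Matrix.IsSymm.ext fun i j => hs.1 j i, ?_⟩
    simpa [Matrix.trace] using hs.2⟩

lemma toSymTraceless_apply (s : State n) (hs : SymmTraceZero s) (i j : Fin n) :
    (toSymTraceless s hs : Matrix (Fin n) (Fin n) ℝ) i j = s.2 i j := rfl

lemma toSymTraceless_eq_zero {s : State n} (hs : SymmTraceZero s) (h : s = 0) :
    toSymTraceless s hs = 0 := by
  subst h
  rfl

/-- The slice t = 0 is a null set, and off it the sequence is eventually constant at each point.
With the uniform bound 6, dominated convergence passes to the limit in the weak equations; the
values prescribed at t = 0 play no role. -/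
lemma IsIteration.solvesLR (hn : 2 ≤ n) (h : IsIteration Ω T z) :
    SolvesLR (fun p => (limitState Ω T z V p).1)
      (fun p => toSymTraceless _ (h.symmTraceZero_limitState (V := V) p)) 0 := by
  have hbdd : ∀ (f φ : Vec n × ℝ → ℝ), ContDiff ℝ ∞ φ → ∀ a p, ‖f p‖ ≤ 6 →
      ‖f p * fderiv ℝ φ p a‖ ≤ 6 * ‖dirDeriv a φ p‖ := fun f φ _ a p hp => by
    rw [norm_mul]
    exact mul_le_mul_of_nonneg_right hp (norm_nonneg _)
  have hint : ∀ (φ : Vec n × ℝ → ℝ), ContDiff ℝ ∞ φ → HasCompactSupport φ → ∀ a,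
      Integrable fun p => 6 * ‖dirDeriv a φ p‖ := fun φ hφ hφc a =>
    (((hφ.dirDeriv a).continuous.integrable_of_hasCompactSupport
      (hφc.fderiv_apply ℝ a)).norm).const_mul 6
  have hloc := h.locallyIntegrable_limitState (V := V) hn
  refine ⟨?_, fun i j => ?_, fun i φ => ?_, fun φ => ?_⟩
  · exact fun p => (hloc p).imp fun s hs => ⟨hs.1, hs.2.fst⟩
  · intro p
    obtain ⟨s, hs, hi⟩ := hloc p
    refine ⟨s, hs, ?_⟩
    simp only [toSymTraceless_apply]
    have h2 : IntegrableOn (fun p => (limitState Ω T z V p).2) s := hi.snd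
    exact (h2.eval i).eval j
  · have hφ : ContDiff ℝ ∞ (φ : Vec n × ℝ → ℝ) := φ.contDiff
    have hφc : HasCompactSupport (φ : Vec n × ℝ → ℝ) := φ.hasCompactSupport
    have hlim := tendsto_integral_of_dominated_convergence
      (F := fun k p => (z k p).1 i * fderiv ℝ φ p (timeDir n) +
        ∑ j, (z k p).2 i j * fderiv ℝ φ p (spaceDir j))
      (f := fun p => (limitState Ω T z V p).1 i * fderiv ℝ φ p (timeDir n) +
        ∑ j, (limitState Ω T z V p).2 i j * fderiv ℝ φ p (spaceDir j))
      (fun p => 6 * ‖dirDeriv (timeDir n) φ p‖ + ∑ j, 6 * ‖dirDeriv (spaceDir j) φ p‖)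
      (fun k => ((integrable_mul_fderiv ((h.isSubsolution k).isFlow.contDiff_fst i).continuous
        hφ hφc _).add (integrable_finsetSum _ fun j _ => integrable_mul_fderiv
          ((h.isSubsolution k).isFlow.contDiff_snd i j).continuous hφ hφc _)).aestronglyMeasurable)
      ((hint φ hφ hφc _).add (integrable_finsetSum _ fun j _ => hint φ hφ hφc _))
      (fun k => Filter.Eventually.of_forall fun p => (norm_add_le _ _).trans (add_le_add
        (hbdd (fun p => (z k p).1 i) φ hφ _ p ((h.isSubsolution k).norm_fst_apply_le hn p i))
        (norm_sum_le_of_le _ fun j _ => hbdd (fun p => (z k p).2 i j) φ hφ _ p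
          ((h.isSubsolution k).norm_snd_apply_le hn p i j))))
      (by
        filter_upwards [h.ae_tendsto_limitState (V := V)] with p hp
        have hc : Continuous fun s : State n => s.1 i * fderiv ℝ φ p (timeDir n) +
            ∑ j, s.2 i j * fderiv ℝ φ p (spaceDir j) := by fun_prop
        exact (hc.tendsto _).comp hp)
    simp only [fun k => (h.isSubsolution k).isFlow.integral_momentum hφ hφc i] at hlim
    have h0 := tendsto_nhds_unique hlim tendsto_const_nhds
    have hq : (∂_{spaceDir i} (0 : 𝓓'((⊤ : TopologicalSpace.Opens (Vec n × ℝ)), ℝ))) φ = 0 := by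
      rw [LineDeriv.lineDerivOp_zero]
      rfl
    rw [hq, add_zero, neg_eq_zero]
    exact h0
  · have hφ : ContDiff ℝ ∞ (φ : Vec n × ℝ → ℝ) := φ.contDiff
    have hφc : HasCompactSupport (φ : Vec n × ℝ → ℝ) := φ.hasCompactSupport
    have hlim := tendsto_integral_of_dominated_convergence
      (F := fun k p => ∑ i, (z k p).1 i * fderiv ℝ φ p (spaceDir i))
      (f := fun p => ∑ i, (limitState Ω T z V p).1 i * fderiv ℝ φ p (spaceDir i))
      (fun p => ∑ i, 6 * ‖dirDeriv (spaceDir i) φ p‖)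
      (fun k => (integrable_finsetSum _ fun i _ => integrable_mul_fderiv
          ((h.isSubsolution k).isFlow.contDiff_fst i).continuous hφ hφc _).aestronglyMeasurable)
      (integrable_finsetSum _ fun j _ => hint φ hφ hφc _)
      (fun k => Filter.Eventually.of_forall fun p =>
        norm_sum_le_of_le _ fun i _ => hbdd (fun p => (z k p).1 i) φ hφ _ p
          ((h.isSubsolution k).norm_fst_apply_le hn p i))
      (by
        filter_upwards [h.ae_tendsto_limitState (V := V)] with p hp
        have hc : Continuous fun s : State n =>
            ∑ i, s.1 i * fderiv ℝ φ p (spaceDir i) := by fun_prop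
        exact (hc.tendsto _).comp hp)
    simp only [fun k => (h.isSubsolution k).isFlow.integral_divergence hφ hφc] at hlim
    exact tendsto_nhds_unique hlim tendsto_const_nhds

lemma IsIteration.smoothOffZero (h : IsIteration Ω T z) :
    SmoothOffZero (fun p => (limitState Ω T z V p).1)
      (fun p => toSymTraceless _ (h.symmTraceZero_limitState (V := V) p)) := by
  refine ⟨fun p hp => ?_, fun i j p hp => ?_⟩
  · exact (contDiff_fst.contDiffAt.comp p (h.contDiffAt_limitState hp)).contDiffWithinAt
  · simp only [toSymTraceless_apply]
    have h2 : ContDiffAt ℝ ∞ (fun p => (limitState Ω T z V p).2) p :=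
      contDiff_snd.contDiffAt.comp p (h.contDiffAt_limitState hp)
    exact (contDiffAt_pi.mp (contDiffAt_pi.mp h2 i) j).contDiffWithinAt

lemma IsSubsolution.continuous_integral_inner (hn : 2 ≤ n) {w : Vec n × ℝ → State n}
    (hw : IsSubsolution Ω w) {g : Vec n → Vec n} (hg : Continuous g)
    (hgc : HasCompactSupport g) :
    Continuous fun t : ℝ => ∫ x, inner ℝ (w (x, t)).1 (g x) := by
  have hc := hw.isFlow.contDiff.continuous
  refine continuous_of_dominated (bound := fun x => 6 * ‖g x‖)
    (fun t => (hw.isFlow.integrable_inner t hg).aestronglyMeasurable)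
    (fun t => Filter.Eventually.of_forall fun x => ?_)
    ((hg.integrable_of_hasCompactSupport hgc).norm.const_mul 6)
    (Filter.Eventually.of_forall fun x => by fun_prop)
  refine (norm_inner_le_norm _ _).trans ?_
  gcongr
  exact (norm_fst_le _).trans (hw.norm_le hn _)

/-- Every slice converges strongly in L²: for t ≠ 0 it is eventually constant, and for t = 0 the
limit is V. Weak smallness supplies the uniform control against smooth compactly supported fields,
which are dense. -/
lemma IsIteration.weaklyContinuousL2 (hn : 2 ≤ n) (hΩ : IsOpen Ω) (hΩb : Bornology.IsBounded Ω)
    (h : IsIteration Ω T z) {V : Lp (Vec n) 2 (volume : Measure (Vec n))}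
    (hV : Filter.Tendsto (fun k => (h.isSubsolution k).isFlow.slice 0) Filter.atTop (nhds V)) :
    WeaklyContinuousL2 fun p => (limitState Ω T z V p).1 := by
  -- V is only an a.e. class; the indicator makes the limit vanish at every point outside Ω, as the
  -- support condition requires, and it changes V only on a null set.
  have hVae : (Ω.indicator V) =ᵐ[volume] V := by
    filter_upwards [(h.ae_limit hn hΩ hΩb hV).1] with x hx
    by_cases hxΩ : x ∈ Ω
    · rw [indicator_of_mem hxΩ]
    · rw [indicator_of_notMem hxΩ, hx hxΩ]
  have hmem : ∀ t : ℝ, MemLp (fun x => (limitState Ω T z V (x, t)).1) 2 volume := by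
    intro t
    by_cases ht : t = 0
    · subst ht
      simp only [limitState_zero]
      exact (memLp_congr_ae hVae).mpr (Lp.memLp V)
    · simp only [limitState_of_ne (Ω := Ω) (T := T) (z := z) (V := V) (p := (_, t)) ht]
      exact (h.isSubsolution _).isFlow.memLp_slice t
  have hlim : ∀ t, Filter.Tendsto (fun k => (h.isSubsolution k).isFlow.slice t) Filter.atTop
      (nhds ((hmem t).toLp _)) := by
    intro t
    by_cases ht : t = 0
    · subst ht
      convert hV using 2
      refine (MemLp.toLp_congr _ (Lp.memLp V) ?_).trans (Lp.toLp_coeFn V (Lp.memLp V))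
      simp only [limitState_zero]
      exact hVae
    · refine tendsto_const_nhds.congr' ?_
      filter_upwards [h.eventually_eq_limitState (V := V) ht] with k hk
      refine MemLp.toLp_congr _ _ (Filter.Eventually.of_forall fun x => ?_)
      simp only [hk]
  refine ⟨hmem, fun φ hφ => ?_⟩
  have hD := Lp.dense_hasCompactSupport_contDiff (E := Vec n) (F := Vec n)
    (μ := (volume : Measure (Vec n))) (p := 2) (by norm_num)
  have hD_toLp : ∀ f ∈ {f : Lp (Vec n) 2 (volume : Measure (Vec n)) | ∃ g : Vec n → Vec n,
      f =ᵐ[volume] g ∧ HasCompactSupport g ∧ ContDiff ℝ ∞ g}, ∃ (g : Vec n → Vec n)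
      (hg : MemLp g 2 volume), f = hg.toLp g ∧ HasCompactSupport g ∧ ContDiff ℝ ∞ g := by
    rintro f ⟨g, hfg, hgc, hg⟩
    have hgm : MemLp g 2 (volume : Measure (Vec n)) :=
      hg.continuous.memLp_of_hasCompactSupport hgc
    refine ⟨g, hgm, ?_, hgc, hg⟩
    exact (Lp.toLp_coeFn f (Lp.memLp f)).symm.trans (MemLp.toLp_congr _ hgm hfg)
  have hcont := continuous_inner_of_tendsto (K := Real.sqrt (2 * volume.real Ω))
    (U := fun k t => (h.isSubsolution k).isFlow.slice t) (fun k t =>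
      Real.le_sqrt_of_sq_le ((h.isSubsolution k).norm_slice_sq_le hn hΩ hΩb t)) hlim hD
    (fun f hf => by
      obtain ⟨g, hgm, rfl, hgc, hg⟩ := hD_toLp f hf
      refine ⟨∫ x, ‖fderiv ℝ g x‖, fun k t => ?_⟩
      unfold IsFlow.slice
      rw [← MemLp.toLp_sub, inner_toLp, mul_comm]
      exact h.weaklySmall k g hg hgc t)
    (fun f hf k => by
      obtain ⟨g, hgm, rfl, hgc, hg⟩ := hD_toLp f hf
      unfold IsFlow.slice
      simp only [inner_toLp]
      exact (h.isSubsolution k).continuous_integral_inner hn hg.continuous hgc)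
    (hφ.toLp φ)
  simpa only [inner_toLp] using hcont

lemma tsupport_pair_toSymTraceless {X : Type*} [TopologicalSpace X] {s : X → State n}
    (hs : ∀ x, SymmTraceZero (s x)) :
    tsupport (fun x => ((s x).1, toSymTraceless (s x) (hs x))) = tsupport s := by
  have : Function.support (fun x => ((s x).1, toSymTraceless (s x) (hs x))) =
      Function.support s := by
    ext x
    simp only [Function.mem_support, ne_eq, not_iff_not]
    refine ⟨fun h => ?_, fun h => ?_⟩
    · obtain ⟨h1, h2⟩ := Prod.mk_eq_zero.mp h
      refine Prod.ext h1 ?_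
      ext i j
      rw [← toSymTraceless_apply _ (hs x), h2]
      rfl
    · rw [toSymTraceless_eq_zero _ h, h]
      rfl
  rw [tsupport, this, tsupport]

end

end EulerSubsolution

end

theorem mainTheorem4 (n : ℕ) (hn : 2 ≤ n) (Ω : Set (EulerSubsolution.Vec n))
    (hΩ : IsOpen Ω) (hΩb : Bornology.IsBounded Ω) (T : ℝ) (hT : 0 < T) :
    ∃ (v : EulerSubsolution.Vec n × ℝ → EulerSubsolution.Vec n)
      (u : EulerSubsolution.Vec n × ℝ → EulerSubsolution.SymTraceless n)
      (q : 𝓓'((⊤ : TopologicalSpace.Opens (EulerSubsolution.Vec n × ℝ)), ℝ)),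
      EulerSubsolution.SolvesLR v u q ∧
      q = 0 ∧
      EulerSubsolution.SmoothOffZero v u ∧
      EulerSubsolution.WeaklyContinuousL2 v ∧
      tsupport (fun p => (v p, u p)) ⊆ closure Ω ×ˢ Ioo (-T) T ∧
      (∀ t : ℝ, t ≠ 0 →
        IsCompact (tsupport fun x => (v (x, t), u (x, t))) ∧
          tsupport (fun x => (v (x, t), u (x, t))) ⊆ Ω) ∧
      (∀ (x : EulerSubsolution.Vec n) (t : ℝ), t ≠ 0 →
        EulerSubsolution.genEnergy (v (x, t)) (u (x, t)) < 1) ∧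
      ∀ᵐ x, x ∈ Ω → 1 / 2 * ‖v (x, 0)‖ ^ 2 = 1 := by

  obtain ⟨z, h⟩ := EulerSubsolution.exists_isIteration hn hΩ hΩb hT
  obtain ⟨V, hV⟩ := h.tendsto_slice_zero hn hΩ hΩb
  refine ⟨fun p => (EulerSubsolution.limitState Ω T z V p).1,
    fun p => EulerSubsolution.toSymTraceless _ (h.symmTraceZero_limitState (V := V) p), 0,
    h.solvesLR hn, rfl, h.smoothOffZero, h.weaklyContinuousL2 hn hΩ hΩb hV, ?_, fun t ht => ?_,
    fun x t ht => ?_, ?_⟩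
  · rw [EulerSubsolution.tsupport_pair_toSymTraceless]
    exact h.tsupport_limitState_subset hT
  · rw [EulerSubsolution.tsupport_pair_toSymTraceless
      (s := fun x => EulerSubsolution.limitState Ω T z V (x, t))]
    exact h.tsupport_slice_limitState ht
  · exact (h.admissible_limitState ht).genEnergy_lt_one (by omega) fun i j => rfl
  · filter_upwards [(h.ae_limit hn hΩ hΩb hV).2] with x hx hxΩ
    simp only [EulerSubsolution.limitState_zero, indicator_of_mem hxΩ, hx hxΩ]
    norm_num
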